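/- Let $L>0$, $\gamma\in\mathbb R$ and $V\in\mathbb C$ (a constant potential). For $u_0:[0,L]\to\mathbb C$ let $U_0:\mathbb R\to\mathbb C$ denote its odd $2L$-periodic extension. Let $$\mathcal H f(x)=\frac1\pi\,\mathrm{P.V.}\!\int_{-\infty}^{\infty}\frac{f(y)}{x-y}\,dy,\qquad (-\Delta)^{1/2}f(x)=\frac1\pi\,\mathrm{P.V.}\!\int_{-\infty}^{\infty}\frac{f(x)-f(y)}{(x-y)^2}\,dy,$$ where the first principal value is taken at $y=x$ and at infinity. A function $u(\cdot,t)$ on $[0,L]$ is identified with its odd $2L$-periodic extension when $(-\Delta)^{1/2}$ is applied to it. Elements of $H^1_0(0,L)$ are represented by their continuous representatives on $[0,L]$, which vanish at $0$ and $L$. **Theorem.** Let $u_0=v_0+\mathrm i w_0$ with real-valued $v_0,w_0\in H^1_0(0,L)$. Then $\mathcal H(U_0)(x)$ exists for every $x\in\mathbb R$; put $$u(x,t)=\frac{e^{-\mathrm iVt}}{2}\Bigl[U_0(x+\gamma t)+U_0(x-\gamma t)-\mathrm i\,\mathcal H(U_0)(x+\gamma t)+\mathrm i\,\mathcal H(U_0)(x-\gamma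 t)\Bigr].$$ (1) If in addition $v_0,w_0\in H^2(0,L)$, then $u$ is a classical solution of $$\mathrm i\,\partial_t u=\gamma(-\Delta)^{1/2}u+Vu\quad\text{on }(0,L)\times(0,\infty),\qquad u(x,0)=u_0(x)\quad\text{for }x\in[0,L],$$ that is, $u$ is continuous on $[0,L]\times[0,\infty)$, the derivative $\partial_tu$ and the principal value $(-\Delta)^{1/2}u$ exist and satisfy the equation at every point of $(0,L)\times(0,\infty)$, and $\operatorname{Re}u(\cdot,t),\operatorname{Im}u(\cdot,t)\in H^1_0(0,L)\cap H^2(0,L)$ for every $t\ge0$. (2) For all $x\in[0,L]$ and $t\ge0$, $$u(x,t)=\frac2L\sum_{n=1}^\infty C_n\sin\Bigl(\frac{\pi nx}{L}\Bigr)e^{-\mathrm i(\gamma\pi n/L+V)t},\qquad C_n=\int_0^L u_0(\xi)\sin\Bigl(\frac{\pi n\xi}{L}\Bigr)d\xi,$$ the series converging absolutely. -/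

import Mathlib

open Filter Topology MeasureTheory
open scoped ContDiff

noncomputable section

/-- `g` is a weak derivative of `v` on the interval `(0, L)`. -/
def IsWeakDeriv (L : ℝ) (v g : ℝ → ℝ) : Prop :=
  ∀ φ : ℝ → ℝ, ContDiff ℝ ∞ φ → HasCompactSupport φ → tsupport φ ⊆ Set.Ioo 0 L →
    ∫ x in Set.Ioo 0 L, v x * deriv φ x = -∫ x in Set.Ioo 0 L, g x * φ x

/-- `v ∈ L²(0, L)`. -/
def MemL2 (L : ℝ) (v : ℝ → ℝ) : Prop :=
  MemLp v 2 (volume.restrict (Set.Ioo 0 L))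

/-- `v ∈ H¹(0, L)`. -/
def MemH1 (L : ℝ) (v : ℝ → ℝ) : Prop :=
  MemL2 L v ∧ ∃ g, MemL2 L g ∧ IsWeakDeriv L v g

/-- `v ∈ H²(0, L)`. -/
def MemH2 (L : ℝ) (v : ℝ → ℝ) : Prop :=
  MemL2 L v ∧ ∃ g, MemL2 L g ∧ IsWeakDeriv L v g ∧ ∃ h, MemL2 L h ∧ IsWeakDeriv L g h

/-- `v` is (the continuous representative of) an element of `H¹₀(0, L)`: it lies in `H¹(0, L)`,
is continuous on `[0, L]`, and vanishes at both end points. -/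
def MemH10 (L : ℝ) (v : ℝ → ℝ) : Prop :=
  MemH1 L v ∧ ContinuousOn v (Set.Icc 0 L) ∧ v 0 = 0 ∧ v L = 0

/-- The representative of `x` modulo `2L` in `[-L, L)`. -/
def reduceMod (L x : ℝ) : ℝ := x - 2 * L * ⌊(x + L) / (2 * L)⌋

/-- The odd `2L`-periodic extension to `ℝ` of a function given on `[0, L]`. -/
def oddPeriodicExt (L : ℝ) (f : ℝ → ℂ) (x : ℝ) : ℂ :=
  if 0 ≤ reduceMod L x then f (reduceMod L x) else -f (-reduceMod L x)

/-- `(1/π) P.V. ∫ f(y) / (x - y) dy = ℓ`, the principal value being taken both at `y = x`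
and at infinity. -/
def HasHilbertTransformAt (f : ℝ → ℂ) (x : ℝ) (ℓ : ℂ) : Prop :=
  (∀ ε R : ℝ, 0 < ε → IntegrableOn (fun y => f y / ((x - y : ℝ) : ℂ))
      {y | ε < |x - y| ∧ |x - y| < R}) ∧
  Tendsto (fun p : ℝ × ℝ => (1 / (Real.pi : ℂ)) *
      ∫ y in {y | p.1 < |x - y| ∧ |x - y| < p.2}, f y / ((x - y : ℝ) : ℂ))
    ((𝓝[>] 0) ×ˢ atTop) (𝓝 ℓ)

open Classical in
/-- The Hilbert transform `H(f)(x) = (1/π) P.V. ∫ f(y) / (x - y) dy` (and `0` where the principal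
value does not exist). -/
def hilbertTransform (f : ℝ → ℂ) (x : ℝ) : ℂ :=
  if h : ∃ ℓ, HasHilbertTransformAt f x ℓ then h.choose else 0

/-- `(-Δ)^{1/2} f (x) = (1/π) P.V. ∫ (f(x) - f(y)) / (x - y)² dy = ℓ`. -/
def HasHalfLaplacianAt (f : ℝ → ℂ) (x : ℝ) (ℓ : ℂ) : Prop :=
  (∀ ε : ℝ, 0 < ε → IntegrableOn (fun y => (f x - f y) / (((x - y) ^ 2 : ℝ) : ℂ))
      {y | ε < |x - y|}) ∧
  Tendsto (fun ε : ℝ => (1 / (Real.pi : ℂ)) *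
      ∫ y in {y | ε < |x - y|}, (f x - f y) / (((x - y) ^ 2 : ℝ) : ℂ))
    (𝓝[>] 0) (𝓝 ℓ)

/-- `u` is a classical solution of `i uₜ = γ (-Δ)^{1/2} u + V u` on `(0, L) × (0, ∞)` with
`u(x, 0) = u₀(x)`, whose real and imaginary parts lie in `H¹₀(0, L) ∩ H²(0, L)` at all times.
The half-Laplacian acts on `u(·, t)` through its odd `2L`-periodic extension. -/
structure IsSchrodingerSolution (L γ : ℝ) (V : ℂ) (u0 : ℝ → ℂ) (u : ℝ → ℝ → ℂ) : Prop where
  continuousOn : ContinuousOn (fun p : ℝ × ℝ => u p.1 p.2) (Set.Icc 0 L ×ˢ Set.Ici 0)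
  mem_re : ∀ t, 0 ≤ t → MemH10 L (fun x => (u x t).re) ∧ MemH2 L (fun x => (u x t).re)
  mem_im : ∀ t, 0 ≤ t → MemH10 L (fun x => (u x t).im) ∧ MemH2 L (fun x => (u x t).im)
  initial : ∀ x ∈ Set.Icc 0 L, u x 0 = u0 x
  equation : ∀ x ∈ Set.Ioo 0 L, ∀ t, 0 < t → ∃ ut ℓ : ℂ,
    HasDerivAt (fun s => u x s) ut t ∧
    HasHalfLaplacianAt (oddPeriodicExt L (fun y => u y t)) x ℓ ∧
    Complex.I * ut = γ * ℓ + V * u x t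

/-- The function `(e^{-iVt}/2) [U(x+γt) + U(x-γt) - i H(U)(x+γt) + i H(U)(x-γt)]`, where `U` is the
odd `2L`-periodic extension of `u0`. -/
def schrodingerWave (L γ : ℝ) (V : ℂ) (u0 : ℝ → ℂ) (x t : ℝ) : ℂ :=
  Complex.exp (-Complex.I * V * t) / 2 *
    (oddPeriodicExt L u0 (x + γ * t) + oddPeriodicExt L u0 (x - γ * t)
      - Complex.I * hilbertTransform (oddPeriodicExt L u0) (x + γ * t)
      + Complex.I * hilbertTransform (oddPeriodicExt L u0) (x - γ * t))

/-- The sine coefficient `C_n = ∫₀ᴸ u₀(ξ) sin(πnξ/L) dξ`. -/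
def sineCoeff (L : ℝ) (u0 : ℝ → ℂ) (n : ℕ) : ℂ :=
  ∫ ξ in (0 : ℝ)..L, u0 ξ * (Real.sin (Real.pi * n * ξ / L) : ℂ)

end

/-! ### The Dirichlet integral -/

/-! The problem is diagonal in the sines `sin (kₙ x)`, `kₙ = π (n + 1) / L`. With the principal
values used here, the Hilbert transform sends `sin (k ·)` to `-cos (k ·)`, and the half-Laplacian
multiplies `sin (k ·)` by `k`. The addition formulas then collapse the bracket in the wave formula,
mode by mode, to `2 sin (k x) e^{-ikγt}`, so the explicit formula and the sine series are the same
function.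

Two points need analysis. The first is exchanging principal values with the infinite sum. Folding
the integral at `x` reduces each mode to `∫ sin (k s) / s` or `∫ (1 - cos (k s)) / s²` over `s > 0`.
The truncations of the former are bounded by `2 + π / 2` whatever `k` and the cut-offs are, those of
the latter by `k π / 2`. Dominated convergence for series therefore applies once `∑ |bₙ|`,
respectively `∑ kₙ |bₙ|`, is finite (`hasHilbertTransformAt_sineSeries`,
`hasHalfLaplacianAt_sineSeries`).

The second is reading that summability off the Sobolev hypotheses. Integration by parts turns `kₙ`
times a sine coefficient of `v ∈ H¹₀` into a cosine coefficient of `v'`, square summable by Bessel;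
since `∑ kₙ⁻²` converges, the sine coefficients are absolutely summable. If also `v ∈ H²`, a second
integration by parts puts `kₙ² bₙ` in `ℓ²` and hence `kₙ bₙ` in `ℓ¹`. The evolution multiplies every
`|bₙ|` by the same factor `e^{Im V t}`, so these bounds persist, and Riesz-Fischer converts them
back into `H²` regularity. -/

theorem integrableOn_and_integral_mul_exp_mul_one_sub_cos {a : ℝ} (ha : 0 < a) :
    IntegrableOn (fun s => a * Real.exp (-(a * s)) * (1 - Real.cos s)) (Set.Ioi 0) ∧
    ∫ s in Set.Ioi 0, a * Real.exp (-(a * s)) * (1 - Real.cos s) = (1 + a ^ 2)⁻¹ := by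
  -- The antiderivative that vanishes at infinity; `Φ 0 = -1 / (a² + 1)` gives the value. The
  -- integrand is nonnegative, so convergence of `Φ` already yields integrability.
  set Φ : ℝ → ℝ := fun s => -Real.exp (-(a * s)) -
    a * (Real.exp (-(a * s)) * (-a * Real.cos s + Real.sin s)) / (a ^ 2 + 1) with hΦ
  have hne : a ^ 2 + 1 ≠ 0 := by positivity
  have hderiv : ∀ s ∈ Set.Ici (0 : ℝ),
      HasDerivAt Φ (a * Real.exp (-(a * s)) * (1 - Real.cos s)) s := by
    intro s _
    have he : HasDerivAt (fun s => Real.exp (-(a * s))) (Real.exp (-(a * s)) * -(a * 1)) s :=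
      (((hasDerivAt_id s).const_mul a).neg).exp
    have ht : HasDerivAt (fun s => -a * Real.cos s + Real.sin s)
        (-a * -Real.sin s + Real.cos s) s :=
      ((Real.hasDerivAt_cos s).const_mul (-a)).add (Real.hasDerivAt_sin s)
    refine (he.neg.sub (((he.mul ht).const_mul a).div_const (a ^ 2 + 1))).congr_deriv ?_
    field_simp
    ring
  have hnonneg : ∀ s ∈ Set.Ioi (0 : ℝ), 0 ≤ a * Real.exp (-(a * s)) * (1 - Real.cos s) :=
    fun s _ => mul_nonneg (by positivity) (by linarith [Real.cos_le_one s])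
  have hexp : Tendsto (fun s : ℝ => Real.exp (-(a * s))) atTop (𝓝 0) :=
    Real.tendsto_exp_neg_atTop_nhds_zero.comp (tendsto_id.const_mul_atTop ha)
  have hlim : Tendsto Φ atTop (𝓝 0) := by
    have h2 : Tendsto (fun s : ℝ => Real.exp (-(a * s)) * (-a * Real.cos s + Real.sin s))
        atTop (𝓝 0) := by
      refine hexp.zero_mul_isBoundedUnder_le ⟨a + 1, ?_⟩
      refine Filter.eventually_map.2 (Eventually.of_forall fun s => ?_)
      refine (norm_add_le _ _).trans ?_
      rw [norm_mul, Real.norm_eq_abs, Real.norm_eq_abs, Real.norm_eq_abs, abs_neg, abs_of_pos ha]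
      nlinarith [Real.abs_cos_le_one s, Real.abs_sin_le_one s]
    have := hexp.neg.sub ((h2.const_mul a).div_const (a ^ 2 + 1))
    simpa [hΦ] using this
  refine ⟨integrableOn_Ioi_deriv_of_nonneg' hderiv hnonneg hlim, ?_⟩
  rw [integral_Ioi_of_hasDerivAt_of_nonneg' hderiv hnonneg hlim]
  simp only [hΦ]
  simp
  field_simp
  ring

theorem integral_mul_exp_neg_mul_Ioi {s : ℝ} (hs : 0 < s) :
    ∫ a in Set.Ioi 0, a * Real.exp (-(a * s)) = 1 / s ^ 2 := by
  have h := Real.integral_rpow_mul_exp_neg_mul_Ioi (a := 2) (by norm_num) hs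
  rw [Real.Gamma_two] at h
  norm_num at h
  simpa [mul_comm s] using h

/-- Writing `1 / s² = ∫ a e^{-as} da` and exchanging the integrals leaves `∫ da / (1 + a²)` over the
half-line. Positivity of the double integrand justifies the exchange. -/
theorem integrableOn_and_integral_one_sub_cos_div_sq :
    IntegrableOn (fun s => (1 - Real.cos s) / s ^ 2) (Set.Ioi 0) ∧
    ∫ s in Set.Ioi 0, (1 - Real.cos s) / s ^ 2 = Real.pi / 2 := by
  set μ : Measure ℝ := volume.restrict (Set.Ioi 0)
  set F : ℝ × ℝ → ℝ := fun p => p.2 * Real.exp (-(p.2 * p.1)) * (1 - Real.cos p.1) with hF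
  have hFc : Continuous F := by fun_prop
  have hpos : ∀ᵐ a ∂μ, 0 < a := ae_restrict_mem measurableSet_Ioi
  have hint : Integrable F (μ.prod μ) := by
    rw [integrable_prod_iff' hFc.aestronglyMeasurable]
    constructor
    · filter_upwards [hpos] with a ha
      exact (integrableOn_and_integral_mul_exp_mul_one_sub_cos ha).1
    · have : Integrable (fun a : ℝ => (1 + a ^ 2)⁻¹) μ := integrable_inv_one_add_sq.integrableOn
      refine this.congr ?_
      filter_upwards [hpos] with a ha
      rw [← (integrableOn_and_integral_mul_exp_mul_one_sub_cos ha).2]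
      refine integral_congr_ae (Eventually.of_forall fun s => ?_)
      refine (Real.norm_of_nonneg ?_).symm
      exact mul_nonneg (by positivity) (by linarith [Real.cos_le_one s])
  have hinner : ∀ᵐ s ∂μ, ∫ a, F (s, a) ∂μ = (1 - Real.cos s) / s ^ 2 := by
    filter_upwards [hpos] with s hs
    simp only [hF]
    rw [integral_mul_const, integral_mul_exp_neg_mul_Ioi hs]
    ring
  refine ⟨hint.integral_prod_left.congr hinner, ?_⟩
  rw [← integral_congr_ae hinner, integral_integral_swap (f := fun s a => F (s, a)) hint]
  have : ∫ a in Set.Ioi (0 : ℝ), (1 + a ^ 2)⁻¹ = Real.pi / 2 := by simp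
  rw [← this]
  refine integral_congr_ae ?_
  filter_upwards [hpos] with a ha
  exact (integrableOn_and_integral_mul_exp_mul_one_sub_cos ha).2

theorem one_sub_cos_div_sq_nonneg (s : ℝ) : 0 ≤ (1 - Real.cos s) / s ^ 2 :=
  div_nonneg (by linarith [Real.cos_le_one s]) (sq_nonneg s)

theorem setIntegral_one_sub_cos_div_sq_le {A : Set ℝ} (hA : A ⊆ Set.Ioi 0) :
    ∫ s in A, (1 - Real.cos s) / s ^ 2 ≤ Real.pi / 2 := by
  rw [← integrableOn_and_integral_one_sub_cos_div_sq.2]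
  exact setIntegral_mono_set integrableOn_and_integral_one_sub_cos_div_sq.1
    (Eventually.of_forall one_sub_cos_div_sq_nonneg) hA.eventuallyLE

theorem abs_one_sub_cos_div_le {s : ℝ} (hs : 0 < s) : |(1 - Real.cos s) / s| ≤ 1 := by
  rw [abs_of_nonneg (div_nonneg (by linarith [Real.cos_le_one s]) hs.le), div_le_one hs]
  rcases le_or_gt s 2 with h | h
  · nlinarith [Real.one_sub_sq_div_two_le_cos (x := s)]
  · linarith [Real.neg_one_le_cos s]

/-- Integration by parts with `1 - cos` as primitive of `sin` trades a conditionally convergent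
integral for an absolutely convergent one; this primitive keeps the boundary term harmless at `0`.
-/
theorem integral_sin_div_eq {ε R : ℝ} (hε : 0 < ε) (hR : ε ≤ R) :
    ∫ s in Set.Ioo ε R, Real.sin s / s =
      (1 - Real.cos R) / R - (1 - Real.cos ε) / ε +
        ∫ s in Set.Ioo ε R, (1 - Real.cos s) / s ^ 2 := by
  have hne : ∀ s ∈ Set.uIcc ε R, s ≠ 0 := fun s hs => by
    rw [Set.uIcc_of_le hR] at hs; linarith [hs.1]
  have h1 : IntervalIntegrable (fun s => Real.sin s / s) volume ε R :=
    (ContinuousOn.div Real.continuous_sin.continuousOn continuousOn_id hne).intervalIntegrable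
  have h2 : IntervalIntegrable (fun s => (1 - Real.cos s) / s ^ 2) volume ε R :=
    (ContinuousOn.div (by fun_prop) (by fun_prop)
      (fun s hs => pow_ne_zero 2 (hne s hs))).intervalIntegrable
  have h := intervalIntegral.integral_eq_sub_of_hasDerivAt
    (f := fun s => (1 - Real.cos s) / s)
    (f' := fun s => Real.sin s / s - (1 - Real.cos s) / s ^ 2) (a := ε) (b := R)
    (fun s hs => by
      have h0 := hne s hs
      refine (((Real.hasDerivAt_cos s).const_sub 1).div (hasDerivAt_id s) h0).congr_deriv ?_
      simp only [id]
      field_simp) (h1.sub h2)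
  rw [intervalIntegral.integral_sub h1 h2] at h
  simp only [intervalIntegral.integral_of_le hR, integral_Ioc_eq_integral_Ioo] at h
  linarith

/-- Each boundary term is at most `1`. Independence of the cut-offs makes this bound survive
rescaling by any frequency, so that it can dominate a whole series. -/
theorem abs_integral_sin_div_le {ε R : ℝ} (hε : 0 < ε) :
    |∫ s in Set.Ioo ε R, Real.sin s / s| ≤ 2 + Real.pi / 2 := by
  rcases le_or_gt ε R with hR | hR
  · rw [integral_sin_div_eq hε hR]
    have h1 := abs_le.1 (abs_one_sub_cos_div_le (hε.trans_le hR))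
    have h2 := abs_le.1 (abs_one_sub_cos_div_le hε)
    have h3 := setIntegral_one_sub_cos_div_sq_le (A := Set.Ioo ε R)
      fun s hs => hε.trans hs.1
    have h4 : 0 ≤ ∫ s in Set.Ioo ε R, (1 - Real.cos s) / s ^ 2 :=
      integral_nonneg fun s => one_sub_cos_div_sq_nonneg s
    rw [abs_le]
    constructor <;> linarith [Real.pi_pos]
  · rw [Set.Ioo_eq_empty (not_lt.2 hR.le)]
    simp
    positivity

theorem tendsto_setIntegral_Ioo_Ioi {f : ℝ → ℝ} (hf : IntegrableOn f (Set.Ioi 0)) :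
    Tendsto (fun p : ℝ × ℝ => ∫ s in Set.Ioo p.1 p.2, f s) ((𝓝[>] 0) ×ˢ atTop)
      (𝓝 (∫ s in Set.Ioi 0, f s)) := by
  have hev : ∀ᶠ p : ℝ × ℝ in (𝓝[>] 0) ×ˢ atTop, ∫ s in Set.Ioo p.1 p.2, f s =
      ∫ s in Set.Ioi 0, (Set.Ioo p.1 p.2).indicator f s := by
    filter_upwards [(eventually_mem_nhdsWithin (a := (0 : ℝ)) (s := Set.Ioi 0)).prod_inl atTop]
      with p hp
    rw [setIntegral_indicator measurableSet_Ioo, Set.inter_eq_right.2]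
    exact fun s hs => lt_trans hp hs.1
  refine Tendsto.congr' (hev.mono fun p hp => hp.symm) ?_
  refine tendsto_integral_filter_of_dominated_convergence (fun s => ‖f s‖)
    (Eventually.of_forall fun p => hf.1.indicator measurableSet_Ioo)
    (Eventually.of_forall fun p => Eventually.of_forall fun s => norm_indicator_le_norm_self _ _)
    hf.norm ?_
  filter_upwards [ae_restrict_mem measurableSet_Ioi] with s hs
  refine tendsto_const_nhds.congr' ?_
  have h1 : ∀ᶠ ε : ℝ in 𝓝[>] 0, ε < s := (eventually_lt_nhds hs).filter_mono nhdsWithin_le_nhds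
  filter_upwards [h1.prod_mk (eventually_gt_atTop s)] with p hp
  exact (Set.indicator_of_mem (Set.mem_Ioo.2 hp) f).symm

theorem tendsto_setIntegral_Ioi_Ioi {f : ℝ → ℝ} (hf : IntegrableOn f (Set.Ioi 0)) :
    Tendsto (fun ε : ℝ => ∫ s in Set.Ioi ε, f s) (𝓝[>] 0) (𝓝 (∫ s in Set.Ioi 0, f s)) := by
  have hev : ∀ᶠ ε : ℝ in 𝓝[>] 0, ∫ s in Set.Ioi ε, f s =
      ∫ s in Set.Ioi 0, (Set.Ioi ε).indicator f s := by
    filter_upwards [eventually_mem_nhdsWithin (a := (0 : ℝ)) (s := Set.Ioi 0)] with p hp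
    rw [setIntegral_indicator measurableSet_Ioi, Set.inter_eq_right.2]
    exact fun s hs => lt_trans (Set.mem_Ioi.1 hp) (Set.mem_Ioi.1 hs)
  refine Tendsto.congr' (hev.mono fun p hp => hp.symm) ?_
  refine tendsto_integral_filter_of_dominated_convergence (fun s => ‖f s‖)
    (Eventually.of_forall fun p => hf.1.indicator measurableSet_Ioi)
    (Eventually.of_forall fun p => Eventually.of_forall fun s => norm_indicator_le_norm_self _ _)
    hf.norm ?_
  filter_upwards [ae_restrict_mem measurableSet_Ioi] with s hs
  refine tendsto_const_nhds.congr' ?_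
  have h1 : ∀ᶠ ε : ℝ in 𝓝[>] 0, ε < s := (eventually_lt_nhds hs).filter_mono nhdsWithin_le_nhds
  filter_upwards [h1] with p hp
  exact (Set.indicator_of_mem (Set.mem_Ioi.2 hp) f).symm

theorem tendsto_integral_sin_div :
    Tendsto (fun p : ℝ × ℝ => ∫ s in Set.Ioo p.1 p.2, Real.sin s / s) ((𝓝[>] 0) ×ˢ atTop)
      (𝓝 (Real.pi / 2)) := by
  have hinf : Tendsto (fun R : ℝ => (1 - Real.cos R) / R) atTop (𝓝 0) := by
    refine Tendsto.congr (fun R => (div_eq_inv_mul _ _).symm)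
      (tendsto_inv_atTop_zero.zero_mul_isBoundedUnder_le ⟨2, ?_⟩)
    refine Filter.eventually_map.2 (Eventually.of_forall fun s => ?_)
    change |1 - Real.cos s| ≤ 2
    rw [abs_le]
    constructor <;> linarith [Real.cos_le_one s, Real.neg_one_le_cos s]
  have hzero : Tendsto (fun ε : ℝ => (1 - Real.cos ε) / ε) (𝓝[>] 0) (𝓝 0) := by
    have h := (Real.hasDerivAt_cos 0).tendsto_slope_zero_right
    refine Tendsto.congr (fun t => ?_) (by simpa using h.neg)
    simp [div_eq_inv_mul]
    ring
  have h := ((hinf.comp tendsto_snd).sub (hzero.comp (tendsto_fst (g := atTop)))).add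
    (tendsto_setIntegral_Ioo_Ioi integrableOn_and_integral_one_sub_cos_div_sq.1)
  rw [integrableOn_and_integral_one_sub_cos_div_sq.2, sub_zero, zero_add] at h
  refine h.congr' ?_
  have h1 : ∀ᶠ ε : ℝ in 𝓝[>] 0, 0 < ε ∧ ε < 1 :=
    (eventually_mem_nhdsWithin).and
      ((eventually_lt_nhds one_pos).filter_mono nhdsWithin_le_nhds)
  filter_upwards [h1.prod_mk (eventually_ge_atTop (1 : ℝ))] with p hp
  exact (integral_sin_div_eq hp.1.1 (hp.1.2.le.trans hp.2)).symm

theorem integral_sin_mul_div {k : ℝ} (hk : 0 < k) {ε R : ℝ} :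
    ∫ s in Set.Ioo ε R, Real.sin (k * s) / s =
      ∫ s in Set.Ioo (k * ε) (k * R), Real.sin s / s := by
  rcases le_or_gt ε R with hR | hR
  · have h := intervalIntegral.integral_comp_mul_left (a := ε) (b := R)
      (fun s => Real.sin s / s) hk.ne'
    rw [smul_eq_mul, intervalIntegral.integral_of_le hR,
      intervalIntegral.integral_of_le (by gcongr), integral_Ioc_eq_integral_Ioo,
      integral_Ioc_eq_integral_Ioo] at h
    rw [← mul_right_inj' (inv_ne_zero hk.ne'), ← h, ← integral_const_mul]
    congr 1
    ext s
    field_simp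
  · rw [Set.Ioo_eq_empty (not_lt.2 hR.le), Set.Ioo_eq_empty (not_lt.2 (by gcongr))]
    simp

theorem abs_integral_sin_mul_div_le {k : ℝ} (hk : 0 < k) {ε R : ℝ} (hε : 0 < ε) :
    |∫ s in Set.Ioo ε R, Real.sin (k * s) / s| ≤ 2 + Real.pi / 2 := by
  rw [integral_sin_mul_div hk]
  exact abs_integral_sin_div_le (by positivity)

theorem tendsto_integral_sin_mul_div {k : ℝ} (hk : 0 < k) :
    Tendsto (fun p : ℝ × ℝ => ∫ s in Set.Ioo p.1 p.2, Real.sin (k * s) / s)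
      ((𝓝[>] 0) ×ˢ atTop) (𝓝 (Real.pi / 2)) := by
  simp_rw [integral_sin_mul_div hk]
  refine tendsto_integral_sin_div.comp (Tendsto.prodMap ?_ (tendsto_id.const_mul_atTop hk))
  refine tendsto_nhdsWithin_iff.2 ⟨?_, ?_⟩
  · have : Tendsto (fun x : ℝ => k * x) (𝓝 0) (𝓝 0) := by
      simpa using (tendsto_id (α := ℝ) (x := 𝓝 0)).const_mul k
    exact this.mono_left nhdsWithin_le_nhds
  · filter_upwards [eventually_mem_nhdsWithin (a := (0 : ℝ)) (s := Set.Ioi 0)] with e he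
    exact mul_pos hk he

theorem integrableOn_one_sub_cos_mul_div_sq {k : ℝ} (hk : 0 < k) :
    IntegrableOn (fun s => (1 - Real.cos (k * s)) / s ^ 2) (Set.Ioi 0) := by
  have h := (integrableOn_Ioi_comp_mul_left_iff
    (fun s => (1 - Real.cos s) / s ^ 2) 0 hk).2
    (by simpa using integrableOn_and_integral_one_sub_cos_div_sq.1)
  refine (h.const_mul (k ^ 2)).congr (Eventually.of_forall fun s => ?_)
  simp only
  field_simp

theorem integral_one_sub_cos_mul_div_sq {k : ℝ} (hk : 0 < k) :
    ∫ s in Set.Ioi 0, (1 - Real.cos (k * s)) / s ^ 2 = k * (Real.pi / 2) := by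
  have h := integral_comp_mul_left_Ioi (fun s => (1 - Real.cos s) / s ^ 2) 0 hk
  rw [mul_zero, integrableOn_and_integral_one_sub_cos_div_sq.2, smul_eq_mul] at h
  have h2 : ∀ s : ℝ, (1 - Real.cos (k * s)) / s ^ 2 =
      k ^ 2 * ((1 - Real.cos (k * s)) / (k * s) ^ 2) := fun s => by field_simp
  simp_rw [h2]
  rw [integral_const_mul, h]
  field_simp

/-! ### Principal values of sine series -/

/-- The frequency `π (n + 1) / L` of the `n`-th sine mode on `[0, L]`. -/
noncomputable def sineFreq (L : ℝ) (n : ℕ) : ℝ := Real.pi * (n + 1 : ℕ) / L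

/-- The sine series `∑ bₙ sin (π (n + 1) x / L)`. -/
noncomputable def sineSeries (L : ℝ) (b : ℕ → ℂ) (x : ℝ) : ℂ :=
  ∑' n, b n * (Real.sin (sineFreq L n * x) : ℂ)

/-- The cosine series `∑ bₙ cos (π (n + 1) x / L)`. -/
noncomputable def cosineSeries (L : ℝ) (b : ℕ → ℂ) (x : ℝ) : ℂ :=
  ∑' n, b n * (Real.cos (sineFreq L n * x) : ℂ)

theorem sineFreq_pos {L : ℝ} (hL : 0 < L) (n : ℕ) : 0 < sineFreq L n := by
  have := Real.pi_pos
  unfold sineFreq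
  positivity

theorem norm_mul_sin_le (b : ℂ) (x : ℝ) : ‖b * (Real.sin x : ℂ)‖ ≤ ‖b‖ := by
  rw [norm_mul, Complex.norm_real]
  exact mul_le_of_le_one_right (norm_nonneg _) (Real.abs_sin_le_one x)

theorem norm_mul_cos_le (b : ℂ) (x : ℝ) : ‖b * (Real.cos x : ℂ)‖ ≤ ‖b‖ := by
  rw [norm_mul, Complex.norm_real]
  exact mul_le_of_le_one_right (norm_nonneg _) (Real.abs_cos_le_one x)

section Series

variable {L : ℝ} {b : ℕ → ℂ}

theorem hasSum_sineSeries (hb : Summable fun n => ‖b n‖) (x : ℝ) :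
    HasSum (fun n => b n * (Real.sin (sineFreq L n * x) : ℂ)) (sineSeries L b x) :=
  (hb.of_norm_bounded fun _ => norm_mul_sin_le _ _).hasSum

theorem hasSum_cosineSeries (hb : Summable fun n => ‖b n‖) (x : ℝ) :
    HasSum (fun n => b n * (Real.cos (sineFreq L n * x) : ℂ)) (cosineSeries L b x) :=
  (hb.of_norm_bounded fun _ => norm_mul_cos_le _ _).hasSum

theorem norm_sineSeries_le (hb : Summable fun n => ‖b n‖) (x : ℝ) :
    ‖sineSeries L b x‖ ≤ ∑' n, ‖b n‖ :=
  tsum_of_norm_bounded hb.hasSum fun _ => norm_mul_sin_le _ _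

theorem continuous_sineSeries (hb : Summable fun n => ‖b n‖) : Continuous (sineSeries L b) :=
  continuous_tsum (fun n => by fun_prop) hb fun _ _ => norm_mul_sin_le _ _

theorem sineSeries_neg (x : ℝ) : sineSeries L b (-x) = -sineSeries L b x := by
  simp [sineSeries, tsum_neg]

theorem sineSeries_sub_period (hL : 0 < L) (x : ℝ) (m : ℤ) :
    sineSeries L b (x - 2 * L * m) = sineSeries L b x := by
  unfold sineSeries
  refine tsum_congr fun n => ?_
  have : sineFreq L n * (x - 2 * L * m) =
      sineFreq L n * x - ((n + 1 : ℕ) * m : ℤ) * (2 * Real.pi) := by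
    unfold sineFreq
    push_cast
    field_simp
  rw [this, Real.sin_sub_int_mul_two_pi]

end Series

/-- Folding the line at `x` performs the cancellation of the principal value: the two branches `y =
x - s` and `y = x + s` are disjoint because `A` lies in `s > 0`. -/
theorem setIntegral_abs_sub_mem {A : Set ℝ} (hA : MeasurableSet A) (hpos : A ⊆ Set.Ioi 0)
    {F : ℝ → ℂ} {x : ℝ} (hF : IntegrableOn F {y | |x - y| ∈ A}) :
    ∫ y in {y | |x - y| ∈ A}, F y = ∫ s in A, (F (x - s) + F (x + s)) := by
  have hset : {y : ℝ | |x - y| ∈ A} = (fun y => x - y) ⁻¹' A ∪ (fun y => y - x) ⁻¹' A := by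
    ext y
    simp only [Set.mem_ofPred_eq, Set.mem_union, Set.mem_preimage]
    constructor
    · intro h
      rcases abs_cases (x - y) with ⟨h1, -⟩ | ⟨h1, -⟩
      · left; rwa [h1] at h
      · right; rwa [h1, neg_sub] at h
    · rintro (h | h)
      · rwa [abs_of_pos (hpos h)]
      · rwa [abs_sub_comm, abs_of_pos (hpos h)]
  have hdisj : Disjoint ((fun y => x - y) ⁻¹' A) ((fun y => y - x) ⁻¹' A) := by
    refine Set.disjoint_left.2 fun y h1 h2 => ?_
    have h1 : 0 < x - y := hpos h1
    have h2 : 0 < y - x := hpos h2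
    linarith
  rw [hset] at hF ⊢
  have mp1 : MeasurePreserving (fun y : ℝ => x - y) := Measure.measurePreserving_sub_left volume x
  have mp2 : MeasurePreserving (fun y : ℝ => y - x) := measurePreserving_sub_right volume x
  have me1 : MeasurableEmbedding (fun y : ℝ => x - y) :=
    (Homeomorph.subLeft x).measurableEmbedding
  have me2 : MeasurableEmbedding (fun y : ℝ => y - x) :=
    (Homeomorph.subRight x).measurableEmbedding
  have i1 : IntegrableOn (fun s => F (x - s)) A := by
    rw [← mp1.integrableOn_comp_preimage me1]
    refine hF.left_of_union.congr (Eventually.of_forall fun y => ?_)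
    simp
  have i2 : IntegrableOn (fun s => F (x + s)) A := by
    rw [← mp2.integrableOn_comp_preimage me2]
    refine hF.right_of_union.congr (Eventually.of_forall fun y => ?_)
    simp
  rw [setIntegral_union hdisj (me2.measurable hA) hF.left_of_union hF.right_of_union,
    integral_add i1 i2, ← mp1.setIntegral_preimage_emb me1 (fun s => F (x - s)) A,
    ← mp2.setIntegral_preimage_emb me2 (fun s => F (x + s)) A]
  simp

theorem hasHilbertTransformAt_unique {f : ℝ → ℂ} {x : ℝ} {ℓ ℓ' : ℂ}
    (h : HasHilbertTransformAt f x ℓ) (h' : HasHilbertTransformAt f x ℓ') : ℓ = ℓ' :=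
  tendsto_nhds_unique h.2 h'.2

theorem HasHilbertTransformAt.hilbertTransform_eq {f : ℝ → ℂ} {x : ℝ} {ℓ : ℂ}
    (h : HasHilbertTransformAt f x ℓ) : hilbertTransform f x = ℓ := by
  have hex : ∃ ℓ, HasHilbertTransformAt f x ℓ := ⟨ℓ, h⟩
  rw [hilbertTransform, dif_pos hex]
  exact hasHilbertTransformAt_unique hex.choose_spec h

section Kernels

variable {L : ℝ} {b : ℕ → ℂ}

theorem integrableOn_sineSeries_div (hb : Summable fun n => ‖b n‖) {x ε R : ℝ} (hε : 0 < ε) :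
    IntegrableOn (fun y => sineSeries L b y / ((x - y : ℝ) : ℂ))
      {y | ε < |x - y| ∧ |x - y| < R} := by
  have hm : MeasurableSet {y : ℝ | ε < |x - y| ∧ |x - y| < R} := by
    have h : Measurable fun y : ℝ => |x - y| := by fun_prop
    exact h (measurableSet_Ioo (a := ε) (b := R))
  refine Measure.integrableOn_of_bounded (M := (∑' n, ‖b n‖) / ε) ?_ ?_ ?_
  · refine ne_top_of_le_ne_top (measure_ball_lt_top (x := x) (r := R)).ne (measure_mono ?_)
    intro y hy
    rw [Metric.mem_ball, dist_comm]
    exact hy.2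
  · have := (continuous_sineSeries (L := L) hb).measurable
    exact Measurable.aestronglyMeasurable (by fun_prop)
  · filter_upwards [ae_restrict_mem hm] with y hy
    rw [norm_div, Complex.norm_real, Real.norm_eq_abs]
    exact div_le_div₀ (tsum_nonneg fun _ => norm_nonneg _) (norm_sineSeries_le hb y) hε hy.1.le

/-- Folding leaves `sin k(x - s) - sin k(x + s) = -2 cos (kx) sin (ks)` over `s`, and the Dirichlet
integral supplies `π / 2` for every `k > 0`. -/
theorem hasHilbertTransformAt_sineSeries (hL : 0 < L) (hb : Summable fun n => ‖b n‖) (x : ℝ) :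
    HasHilbertTransformAt (sineSeries L b) x (-cosineSeries L b x) := by
  refine ⟨fun ε R hε => integrableOn_sineSeries_div hb hε, ?_⟩
  set D : ℕ → ℝ × ℝ → ℝ := fun n p => ∫ s in Set.Ioo p.1 p.2, Real.sin (sineFreq L n * s) / s
  set c : ℕ → ℂ := fun n => b n * (Real.cos (sineFreq L n * x) : ℂ) with hc
  have hcb : ∀ n, ‖c n‖ ≤ ‖b n‖ := fun n => norm_mul_cos_le _ _
  have hkey : ∀ p : ℝ × ℝ, 0 < p.1 →
      ∫ y in {y | p.1 < |x - y| ∧ |x - y| < p.2}, sineSeries L b y / ((x - y : ℝ) : ℂ) =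
        ∑' n, -2 * c n * (D n p : ℂ) := by
    intro p hp
    have h := setIntegral_abs_sub_mem (A := Set.Ioo p.1 p.2) measurableSet_Ioo
      (fun s hs => hp.trans hs.1) (integrableOn_sineSeries_div (L := L) hb (x := x) (R := p.2) hp)
    refine h.trans ?_
    have hpt : ∀ s ∈ Set.Ioo p.1 p.2,
        sineSeries L b (x - s) / ((x - (x - s) : ℝ) : ℂ) +
          sineSeries L b (x + s) / ((x - (x + s) : ℝ) : ℂ) =
        ∑' n, -2 * c n * ((Real.sin (sineFreq L n * s) / s : ℝ) : ℂ) := by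
      intro s hs
      refine (HasSum.tsum_eq ?_).symm
      refine (((hasSum_sineSeries hb (x - s)).div_const _).add
        ((hasSum_sineSeries hb (x + s)).div_const _)).congr_fun fun n => ?_
      have hs0 : (s : ℂ) ≠ 0 := by exact_mod_cast (hp.trans hs.1).ne'
      rw [mul_sub, mul_add, Real.sin_sub, Real.sin_add, sub_sub_cancel, sub_add_cancel_left]
      simp only [hc]
      push_cast
      field_simp
      ring
    rw [setIntegral_congr_fun measurableSet_Ioo hpt]
    have hcont : ∀ n, ContinuousOn
        (fun s : ℝ => -2 * c n * ((Real.sin (sineFreq L n * s) / s : ℝ) : ℂ))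
        (Set.Icc p.1 p.2) := fun n => by
      have : ContinuousOn (fun s : ℝ => Real.sin (sineFreq L n * s) / s) (Set.Icc p.1 p.2) :=
        ContinuousOn.div (by fun_prop) continuousOn_id fun s hs => (hp.trans_le hs.1).ne'
      fun_prop
    have hint : ∀ n, IntegrableOn
        (fun s : ℝ => -2 * c n * ((Real.sin (sineFreq L n * s) / s : ℝ) : ℂ))
        (Set.Ioo p.1 p.2) := fun n =>
      ((hcont n).integrableOn_compact isCompact_Icc).mono_set Set.Ioo_subset_Icc_self
    have hsum := hasSum_integral_of_summable_integral_norm hint ?_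
    · rw [← hsum.tsum_eq]
      refine tsum_congr fun n => ?_
      rw [integral_const_mul]
      congr 1
      exact integral_ofReal
    · refine Summable.of_nonneg_of_le (fun n => integral_nonneg fun s => norm_nonneg _)
        (fun n => ?_) (hb.mul_right (2 / p.1 * volume.real (Set.Ioo p.1 p.2)))
      -- For fixed cut-offs the crude bound `1 / s ≤ 1 / ε` suffices to integrate termwise; the
      -- uniform bound is needed only for the limit below.
      have hbd : ∀ s ∈ Set.Ioo p.1 p.2,
          ‖‖-2 * c n * ((Real.sin (sineFreq L n * s) / s : ℝ) : ℂ)‖‖ ≤ 2 * ‖b n‖ / p.1 := by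
        intro s hs
        have hs0 : 0 < s := hp.trans hs.1
        rw [norm_norm, norm_mul, norm_mul, Complex.norm_real, norm_div, norm_neg,
          Complex.norm_ofNat, Real.norm_eq_abs, Real.norm_eq_abs, abs_of_pos hs0,
          mul_div_assoc']
        refine div_le_div₀ (by positivity) ?_ hp hs.1.le
        calc 2 * ‖c n‖ * |Real.sin (sineFreq L n * s)| ≤ 2 * ‖b n‖ * 1 := by
              gcongr
              · exact hcb n
              · exact Real.abs_sin_le_one _
          _ = _ := mul_one _
      refine (Real.le_norm_self _).trans
        ((norm_setIntegral_le_of_norm_le_const measure_Ioo_lt_top hbd).trans (le_of_eq ?_))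
      ring
  have hlim : Tendsto (fun p : ℝ × ℝ => (1 / (Real.pi : ℂ)) * ∑' n, -2 * c n * (D n p : ℂ))
      ((𝓝[>] 0) ×ˢ atTop) (𝓝 ((1 / (Real.pi : ℂ)) * ∑' n, -2 * c n * ((Real.pi / 2 : ℝ) : ℂ))) := by
    refine Tendsto.const_mul _ ?_
    refine tendsto_tsum_of_dominated_convergence
      (bound := fun n => 2 * ‖b n‖ * (2 + Real.pi / 2)) ?_ ?_ ?_
    · exact (hb.mul_left 2).mul_right _
    · intro n
      exact ((Complex.continuous_ofReal.tendsto _).comp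
        (tendsto_integral_sin_mul_div (sineFreq_pos hL n))).const_mul _
    · filter_upwards [(eventually_mem_nhdsWithin (a := (0 : ℝ)) (s := Set.Ioi 0)).prod_inl atTop]
        with p hp n
      rw [norm_mul, norm_mul, Complex.norm_real, norm_neg, Complex.norm_ofNat, Real.norm_eq_abs]
      gcongr
      · exact hcb n
      · exact abs_integral_sin_mul_div_le (sineFreq_pos hL n) hp
  have hval : (1 / (Real.pi : ℂ)) * ∑' n, -2 * c n * ((Real.pi / 2 : ℝ) : ℂ) =
      -cosineSeries L b x := by
    have hpi : (Real.pi : ℂ) ≠ 0 := by exact_mod_cast Real.pi_ne_zero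
    rw [tsum_mul_right, tsum_mul_left]
    change _ = -∑' n, c n
    push_cast
    field_simp
  rw [hval] at hlim
  refine hlim.congr' ?_
  filter_upwards [(eventually_mem_nhdsWithin (a := (0 : ℝ)) (s := Set.Ioi 0)).prod_inl atTop]
    with p hp
  rw [hkey p hp]

theorem integrableOn_inv_sq_abs_sub {x ε : ℝ} (hε : 0 < ε) :
    IntegrableOn (fun y => ((x - y) ^ 2)⁻¹) {y : ℝ | ε < |x - y|} := by
  have h0 : Integrable (fun y : ℝ => (1 + (x - y) ^ 2)⁻¹) :=
    integrable_inv_one_add_sq.comp_sub_left x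
  have hm : MeasurableSet {y : ℝ | ε < |x - y|} := by
    have h : Measurable fun y : ℝ => |x - y| := by fun_prop
    exact h (measurableSet_Ioi (a := ε))
  refine Integrable.mono' (h0.integrableOn.const_mul (1 + (ε ^ 2)⁻¹))
    (Measurable.aestronglyMeasurable (by fun_prop)) ?_
  filter_upwards [ae_restrict_mem hm] with y hy
  have hsq : ε ^ 2 ≤ (x - y) ^ 2 := by
    rw [← sq_abs (x - y)]
    exact pow_le_pow_left₀ hε.le (le_of_lt hy) 2
  have hpos : 0 < (x - y) ^ 2 := (by positivity : 0 < ε ^ 2).trans_le hsq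
  rw [Real.norm_of_nonneg (by positivity), ← div_eq_mul_inv, le_div_iff₀ (by positivity), mul_add,
    inv_mul_cancel₀ hpos.ne', mul_one, add_comm]
  gcongr

theorem integrableOn_sineSeries_sub_div (hb : Summable fun n => ‖b n‖) {x ε : ℝ} (hε : 0 < ε) :
    IntegrableOn (fun y => (sineSeries L b x - sineSeries L b y) / (((x - y) ^ 2 : ℝ) : ℂ))
      {y | ε < |x - y|} := by
  refine Integrable.mono'
    ((integrableOn_inv_sq_abs_sub (x := x) hε).const_mul (2 * ∑' n, ‖b n‖)) ?_ ?_
  · have := (continuous_sineSeries (L := L) hb).measurable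
    exact Measurable.aestronglyMeasurable (by fun_prop)
  · refine Eventually.of_forall fun y => ?_
    rw [norm_div, Complex.norm_real, norm_pow, Real.norm_eq_abs, sq_abs, div_eq_mul_inv]
    gcongr
    refine (norm_sub_le _ _).trans ?_
    linarith [norm_sineSeries_le (L := L) hb x, norm_sineSeries_le (L := L) hb y]

/-- Folding leaves `2 sin (kx) (1 - cos (ks)) / s²`. Its integral over `s > 0` is `k π sin (kx)`,
and positivity of the kernel bounds every truncation by the full integral; hence the weight `k` in
the second hypothesis. -/
theorem hasHalfLaplacianAt_sineSeries (hL : 0 < L) (hb : Summable fun n => ‖b n‖)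
    (hb' : Summable fun n => ‖b n‖ * sineFreq L n) (x : ℝ) :
    HasHalfLaplacianAt (sineSeries L b) x (sineSeries L (fun n => sineFreq L n * b n) x) := by
  refine ⟨fun ε hε => integrableOn_sineSeries_sub_div hb hε, ?_⟩
  set D : ℕ → ℝ → ℝ := fun n ε => ∫ s in Set.Ioi ε, (1 - Real.cos (sineFreq L n * s)) / s ^ 2
  set c : ℕ → ℂ := fun n => b n * (Real.sin (sineFreq L n * x) : ℂ) with hc
  have hcb : ∀ n, ‖c n‖ ≤ ‖b n‖ := fun n => norm_mul_sin_le _ _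
  have hqn : ∀ n s, 0 ≤ (1 - Real.cos (sineFreq L n * s)) / s ^ 2 := fun n s =>
    div_nonneg (by linarith [Real.cos_le_one (sineFreq L n * s)]) (sq_nonneg s)
  have hDn : ∀ n ε, 0 ≤ D n ε := fun n ε => integral_nonneg (hqn n)
  have hDle : ∀ n ε, 0 < ε → D n ε ≤ sineFreq L n * (Real.pi / 2) := fun n ε hε => by
    rw [← integral_one_sub_cos_mul_div_sq (sineFreq_pos hL n)]
    exact setIntegral_mono_set (integrableOn_one_sub_cos_mul_div_sq (sineFreq_pos hL n))
      (Eventually.of_forall (hqn n)) (Set.Ioi_subset_Ioi hε.le).eventuallyLE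
  have hkey : ∀ ε : ℝ, 0 < ε →
      ∫ y in {y | ε < |x - y|}, (sineSeries L b x - sineSeries L b y) / (((x - y) ^ 2 : ℝ) : ℂ) =
        ∑' n, 2 * c n * (D n ε : ℂ) := by
    intro ε hε
    have h := setIntegral_abs_sub_mem (A := Set.Ioi ε) measurableSet_Ioi
      (fun s hs => hε.trans hs) (integrableOn_sineSeries_sub_div (L := L) hb (x := x) hε)
    refine h.trans ?_
    have hpt : ∀ s ∈ Set.Ioi ε,
        (sineSeries L b x - sineSeries L b (x - s)) / (((x - (x - s)) ^ 2 : ℝ) : ℂ) +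
          (sineSeries L b x - sineSeries L b (x + s)) / (((x - (x + s)) ^ 2 : ℝ) : ℂ) =
        ∑' n, 2 * c n * (((1 - Real.cos (sineFreq L n * s)) / s ^ 2 : ℝ) : ℂ) := by
      intro s hs
      refine (HasSum.tsum_eq ?_).symm
      refine ((((hasSum_sineSeries hb x).sub (hasSum_sineSeries hb (x - s))).div_const _).add
        (((hasSum_sineSeries hb x).sub (hasSum_sineSeries hb (x + s))).div_const _)).congr_fun fun n => ?_
      have hs0 : (s : ℂ) ≠ 0 := by exact_mod_cast (hε.trans hs).ne'
      rw [mul_sub, mul_add, Real.sin_sub, Real.sin_add, sub_sub_cancel, sub_add_cancel_left]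
      simp only [hc]
      push_cast
      field_simp
      ring
    rw [setIntegral_congr_fun measurableSet_Ioi hpt]
    have hint : ∀ n, IntegrableOn
        (fun s : ℝ => 2 * c n * (((1 - Real.cos (sineFreq L n * s)) / s ^ 2 : ℝ) : ℂ))
        (Set.Ioi ε) := fun n =>
      (((integrableOn_one_sub_cos_mul_div_sq (sineFreq_pos hL n)).mono_set
        (Set.Ioi_subset_Ioi hε.le)).ofReal).const_mul _
    have hsum := hasSum_integral_of_summable_integral_norm hint ?_
    · rw [← hsum.tsum_eq]
      refine tsum_congr fun n => ?_
      rw [integral_const_mul]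
      congr 1
      exact integral_ofReal
    · refine Summable.of_nonneg_of_le (fun n => integral_nonneg fun s => norm_nonneg _)
        (fun n => ?_) (hb'.mul_right Real.pi)
      have : ∀ s, ‖2 * c n * (((1 - Real.cos (sineFreq L n * s)) / s ^ 2 : ℝ) : ℂ)‖ =
          2 * ‖c n‖ * ((1 - Real.cos (sineFreq L n * s)) / s ^ 2) := fun s => by
        rw [norm_mul, norm_mul, Complex.norm_real, Complex.norm_ofNat,
          Real.norm_of_nonneg (hqn n s)]
      simp_rw [this]
      rw [integral_const_mul]
      calc 2 * ‖c n‖ * D n ε ≤ 2 * ‖b n‖ * (sineFreq L n * (Real.pi / 2)) := by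
            gcongr
            · exact hDn n ε
            · exact hcb n
            · exact hDle n ε hε
        _ = _ := by ring
  have hlim : Tendsto (fun ε : ℝ => (1 / (Real.pi : ℂ)) * ∑' n, 2 * c n * (D n ε : ℂ))
      (𝓝[>] 0) (𝓝 ((1 / (Real.pi : ℂ)) *
        ∑' n, 2 * c n * ((sineFreq L n * (Real.pi / 2) : ℝ) : ℂ))) := by
    refine Tendsto.const_mul _ ?_
    refine tendsto_tsum_of_dominated_convergence
      (bound := fun n => ‖b n‖ * sineFreq L n * Real.pi) (hb'.mul_right _) ?_ ?_
    · intro n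
      rw [← integral_one_sub_cos_mul_div_sq (sineFreq_pos hL n)]
      exact ((Complex.continuous_ofReal.tendsto _).comp (tendsto_setIntegral_Ioi_Ioi
        (integrableOn_one_sub_cos_mul_div_sq (sineFreq_pos hL n)))).const_mul _
    · filter_upwards [eventually_mem_nhdsWithin (a := (0 : ℝ)) (s := Set.Ioi 0)] with ε hε n
      rw [norm_mul, norm_mul, Complex.norm_real, Complex.norm_ofNat,
        Real.norm_of_nonneg (hDn n ε)]
      calc 2 * ‖c n‖ * D n ε ≤ 2 * ‖b n‖ * (sineFreq L n * (Real.pi / 2)) := by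
            gcongr
            · exact hDn n ε
            · exact hcb n
            · exact hDle n ε hε
        _ = _ := by ring
  have hval : (1 / (Real.pi : ℂ)) * ∑' n, 2 * c n * ((sineFreq L n * (Real.pi / 2) : ℝ) : ℂ) =
      sineSeries L (fun n => sineFreq L n * b n) x := by
    have hpi : (Real.pi : ℂ) ≠ 0 := by exact_mod_cast Real.pi_ne_zero
    rw [← tsum_mul_left, sineSeries]
    refine tsum_congr fun n => ?_
    simp only [hc]
    push_cast
    field_simp
  rw [hval] at hlim
  refine hlim.congr' ?_
  filter_upwards [eventually_mem_nhdsWithin (a := (0 : ℝ)) (s := Set.Ioi 0)] with ε hε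
  rw [hkey ε hε]

end Kernels

/-! ### Sine expansion of the odd periodic extension -/

theorem sineFreq_mul (L : ℝ) (n : ℕ) (x : ℝ) :
    sineFreq L n * x = Real.pi * (n + 1 : ℕ) * x / L :=
  div_mul_eq_mul_div _ _ _

section Expansion

variable {L : ℝ} {u0 : ℝ → ℂ}

theorem oddPeriodicExt_congr (hL : 0 < L) {f g : ℝ → ℂ} (h : ∀ x ∈ Set.Icc 0 L, f x = g x) :
    oddPeriodicExt L f = oddPeriodicExt L g := by
  ext x
  have h2L : (0 : ℝ) < 2 * L := by positivity
  have h1 : reduceMod L x < L := by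
    have := (div_lt_iff₀ h2L).1 (Int.lt_floor_add_one ((x + L) / (2 * L)))
    unfold reduceMod
    linarith
  have h2 : -L ≤ reduceMod L x := by
    have := (le_div_iff₀ h2L).1 (Int.floor_le ((x + L) / (2 * L)))
    unfold reduceMod
    linarith
  unfold oddPeriodicExt
  split_ifs with h0
  · exact h _ ⟨h0, h1.le⟩
  · rw [h _ ⟨by linarith, by linarith⟩]

theorem oddPeriodicExt_sineSeries (hL : 0 < L) (b : ℕ → ℂ) :
    oddPeriodicExt L (sineSeries L b) = sineSeries L b := by
  ext x
  unfold oddPeriodicExt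
  rw [sineSeries_neg, neg_neg, ite_self, reduceMod, sineSeries_sub_period hL]

/-- The odd reflection of a function vanishing at the origin. -/
noncomputable def oddReflection (u0 : ℝ → ℂ) (x : ℝ) : ℂ := u0 (max x 0) - u0 (max (-x) 0)

theorem oddReflection_of_nonneg (h0 : u0 0 = 0) {x : ℝ} (hx : 0 ≤ x) :
    oddReflection u0 x = u0 x := by
  simp [oddReflection, hx, h0]

theorem oddReflection_neg (x : ℝ) : oddReflection u0 (-x) = -oddReflection u0 x := by
  simp [oddReflection]

theorem continuousOn_oddReflection (hL : 0 < L) (hc : ContinuousOn u0 (Set.Icc 0 L)) :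
    ContinuousOn (oddReflection u0) (Set.Icc (-L) L) := by
  refine ContinuousOn.sub (hc.comp (by fun_prop) fun x hx => ?_)
    (hc.comp (by fun_prop) fun x hx => ?_)
  · exact ⟨le_max_right _ _, max_le hx.2 hL.le⟩
  · exact ⟨le_max_right _ _, max_le (by linarith [hx.1]) hL.le⟩

theorem integral_exp_mul_oddReflection (hL : 0 < L) (h0 : u0 0 = 0)
    (hc : ContinuousOn u0 (Set.Icc 0 L)) (n : ℤ) :
    ∫ x in (-L)..L, Complex.exp (-(Real.pi * n * x / L : ℝ) * Complex.I) * oddReflection u0 x =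
      -2 * Complex.I * ∫ x in (0 : ℝ)..L, u0 x * (Real.sin (Real.pi * n * x / L) : ℂ) := by
  set g : ℝ → ℂ := fun x =>
    Complex.exp (-(Real.pi * n * x / L : ℝ) * Complex.I) * oddReflection u0 x with hg
  have hgc : ContinuousOn g (Set.Icc (-L) L) :=
    ContinuousOn.mul (by fun_prop) (continuousOn_oddReflection hL hc)
  have hneg : ContinuousOn (fun x => g (-x)) (Set.Icc (-L) L) :=
    hgc.comp (by fun_prop) fun x hx => ⟨by linarith [hx.2], by linarith [hx.1]⟩
  have hi : ∀ {h : ℝ → ℂ} {a b : ℝ}, a ∈ Set.Icc (-L) L → b ∈ Set.Icc (-L) L →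
      ContinuousOn h (Set.Icc (-L) L) → IntervalIntegrable h volume a b :=
    fun ha hb hh => (hh.mono (Set.uIcc_subset_Icc ha hb)).intervalIntegrable
  have hm0 : (0 : ℝ) ∈ Set.Icc (-L) L := ⟨by linarith, hL.le⟩
  have hml : -L ∈ Set.Icc (-L) L := ⟨le_rfl, by linarith⟩
  have hmr : L ∈ Set.Icc (-L) L := ⟨by linarith, le_rfl⟩
  rw [← intervalIntegral.integral_add_adjacent_intervals (hi hml hm0 hgc) (hi hm0 hmr hgc)]
  have hflip : ∫ x in (-L)..0, g x = ∫ x in (0 : ℝ)..L, g (-x) := by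
    rw [intervalIntegral.integral_comp_neg, neg_zero]
  rw [hflip, ← intervalIntegral.integral_add (hi hm0 hmr hneg) (hi hm0 hmr hgc),
    ← intervalIntegral.integral_const_mul]
  refine intervalIntegral.integral_congr fun x hx => ?_
  rw [Set.uIcc_of_le hL.le] at hx
  simp only [hg]
  rw [oddReflection_neg, oddReflection_of_nonneg h0 hx.1, Complex.ofReal_sin, Complex.sin]
  have e1 : ((Real.pi * n * -x / L : ℝ) : ℂ) = -((Real.pi * n * x / L : ℝ) : ℂ) := by
    push_cast; ring
  rw [e1, neg_neg]
  linear_combination (Complex.exp (-((Real.pi * n * x / L : ℝ) : ℂ) * Complex.I) -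
    Complex.exp (((Real.pi * n * x / L : ℝ) : ℂ) * Complex.I)) * u0 x * Complex.I_sq

/-- Since `u0 L = 0`, the odd reflection takes equal values at `±L` and descends to a continuous
function on the circle of length `2L`. Its Fourier coefficients are summable, so its Fourier series
converges to it pointwise. -/
theorem hasSum_sineCoeff (hL : 0 < L) (h0 : u0 0 = 0) (hL0 : u0 L = 0)
    (hc : ContinuousOn u0 (Set.Icc 0 L)) (hs : Summable fun n => ‖sineCoeff L u0 (n + 1)‖)
    {x : ℝ} (hx : x ∈ Set.Ico 0 L) :
    HasSum (fun n : ℕ => 2 / (L : ℂ) * sineCoeff L u0 (n + 1) * (Real.sin (sineFreq L n * x) : ℂ))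
      (u0 x) := by
  have : Fact (0 < 2 * L) := ⟨by positivity⟩
  have hLc : (L : ℂ) ≠ 0 := by exact_mod_cast hL.ne'
  set S : ℤ → ℂ := fun n => ∫ x in (0 : ℝ)..L, u0 x * (Real.sin (Real.pi * n * x / L) : ℂ) with hS
  have hSn : ∀ n : ℕ, S n = sineCoeff L u0 n := fun n => by simp [hS, sineCoeff]
  have hSneg : ∀ n : ℤ, S (-n) = -S n := fun n => by
    simp only [hS]
    rw [← intervalIntegral.integral_neg]
    refine intervalIntegral.integral_congr fun x _ => ?_
    have : Real.pi * (-n : ℤ) * x / L = -(Real.pi * n * x / L) := by push_cast; ring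
    simp only [this, Real.sin_neg]
    push_cast
    ring
  have hS0 : S 0 = 0 := by simp [hS]
  have hend : -L + 2 * L = L := by ring
  have hFc : Continuous (AddCircle.liftIco (2 * L) (-L) (oddReflection u0)) := by
    refine AddCircle.liftIco_continuous ?_ ?_
    · rw [hend, oddReflection_neg, oddReflection_of_nonneg h0 hL.le, hL0, neg_zero]
    · rw [hend]
      exact continuousOn_oddReflection hL hc
  set F : C(AddCircle (2 * L), ℂ) := ⟨_, hFc⟩
  have hcoef : ∀ n : ℤ, fourierCoeff F n = -(Complex.I / L) * S n := by
    intro n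
    change fourierCoeff (AddCircle.liftIco (2 * L) (-L) (oddReflection u0)) n = _
    rw [fourierCoeff_liftIco_eq, fourierCoeffOn_eq_integral, hend]
    have : ∀ x : ℝ, fourier (-n) (x : AddCircle (L - -L)) • oddReflection u0 x =
        Complex.exp (-(Real.pi * n * x / L : ℝ) * Complex.I) * oddReflection u0 x := by
      intro x
      rw [fourier_coe_apply, smul_eq_mul]
      congr 2
      push_cast
      field_simp
      ring
    simp_rw [this]
    rw [integral_exp_mul_oddReflection hL h0 hc, Complex.real_smul]
    change _ * (_ * S n) = _
    push_cast
    field_simp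
    ring
  have hsum : Summable (fourierCoeff F) := by
    have hnat : Summable fun n : ℕ => -(Complex.I / L) * S n := by
      refine Summable.mul_left _ ((summable_nat_add_iff 1).1 ?_)
      refine Summable.of_norm ?_
      simp_rw [hSn]
      exact hs
    refine Summable.of_nat_of_neg ?_ ?_
    · simp_rw [hcoef]
      exact hnat
    · simp_rw [hcoef, hSneg, mul_neg]
      exact hnat.neg
  -- Pairing `n` with `-n` counts the mode `n = 0` twice, which is harmless since `S 0 = 0`.
  have hpt := (has_pointwise_sum_fourier_series_of_summable hsum (x : AddCircle (2 * L))).nat_add_neg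
  have hFx : F (x : AddCircle (2 * L)) = u0 x := by
    change AddCircle.liftIco (2 * L) (-L) (oddReflection u0) (x : AddCircle (2 * L)) = _
    rw [AddCircle.liftIco_coe_apply ⟨by linarith [hx.1], by linarith [hx.2]⟩,
      oddReflection_of_nonneg h0 hx.1]
  rw [hFx, hcoef, hS0, mul_zero, zero_smul, add_zero] at hpt
  have hterm : ∀ n : ℕ, fourierCoeff F n • fourier n (x : AddCircle (2 * L)) +
      fourierCoeff F (-n) • fourier (-n : ℤ) (x : AddCircle (2 * L)) =
      2 / (L : ℂ) * S n * (Real.sin (Real.pi * n * x / L) : ℂ) := by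
    intro n
    rw [hcoef, hcoef, hSneg, fourier_coe_apply, fourier_coe_apply, Complex.ofReal_sin, Complex.sin,
      smul_eq_mul, smul_eq_mul]
    have e1 : 2 * (Real.pi : ℂ) * Complex.I * ((n : ℤ) : ℂ) * x / ((2 * L : ℝ) : ℂ) =
        ((Real.pi * n * x / L : ℝ) : ℂ) * Complex.I := by
      push_cast
      field_simp
    have e2 : 2 * (Real.pi : ℂ) * Complex.I * ((-n : ℤ) : ℂ) * x / ((2 * L : ℝ) : ℂ) =
        -((Real.pi * n * x / L : ℝ) : ℂ) * Complex.I := by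
      push_cast
      field_simp
    rw [e1, e2]
    field_simp
    ring
  simp_rw [hterm] at hpt
  have hshift := (hasSum_nat_add_iff' 1).2 hpt
  simp only [Finset.range_one, Finset.sum_singleton, Nat.cast_zero, hS0, mul_zero, zero_mul,
    sub_zero] at hshift
  refine hshift.congr_fun fun n => ?_
  rw [hSn, sineFreq_mul]

theorem sineSeries_sineCoeff_eq (hL : 0 < L) (h0 : u0 0 = 0) (hL0 : u0 L = 0)
    (hc : ContinuousOn u0 (Set.Icc 0 L)) (hs : Summable fun n => ‖sineCoeff L u0 (n + 1)‖)
    {x : ℝ} (hx : x ∈ Set.Icc 0 L) :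
    sineSeries L (fun n => 2 / (L : ℂ) * sineCoeff L u0 (n + 1)) x = u0 x := by
  rcases hx.2.lt_or_eq with h | rfl
  · exact (hasSum_sineCoeff hL h0 hL0 hc hs ⟨hx.1, h⟩).tsum_eq
  · rw [hL0, sineSeries]
    refine (tsum_congr fun n => ?_).trans tsum_zero
    have : sineFreq x n * x = (n + 1 : ℕ) * Real.pi := by
      unfold sineFreq
      field_simp
    rw [this, Real.sin_nat_mul_pi, Complex.ofReal_zero, mul_zero]

theorem oddPeriodicExt_eq_sineSeries (hL : 0 < L) (h0 : u0 0 = 0) (hL0 : u0 L = 0)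
    (hc : ContinuousOn u0 (Set.Icc 0 L)) (hs : Summable fun n => ‖sineCoeff L u0 (n + 1)‖) :
    oddPeriodicExt L u0 = sineSeries L fun n => 2 / (L : ℂ) * sineCoeff L u0 (n + 1) := by
  rw [← oddPeriodicExt_sineSeries hL]
  exact oddPeriodicExt_congr hL fun x hx => (sineSeries_sineCoeff_eq hL h0 hL0 hc hs hx).symm

end Expansion

/-! ### Weak derivatives on an interval and sine coefficients -/

section Weak

variable {L : ℝ} {v g : ℝ → ℝ}

theorem MemL2.integrableOn (h : MemL2 L v) : IntegrableOn v (Set.Ioo 0 L) :=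
  MemLp.integrable (by norm_num) h

theorem MemL2.intervalIntegrable (hL : 0 < L) (h : MemL2 L v) : IntervalIntegrable v volume 0 L :=
  (intervalIntegrable_iff_integrableOn_Ioo_of_le hL.le).2 h.integrableOn

/-- Integration by parts for the primitive of an integrable function. -/
theorem integral_primitive_mul_deriv (hg : IntervalIntegrable g volume 0 L)
    (c : ℝ) {ψ : ℝ → ℝ} (hψ : ContDiff ℝ 1 ψ) :
    ∫ x in (0 : ℝ)..L, (c + ∫ t in (0 : ℝ)..x, g t) * deriv ψ x =
      (c + ∫ t in (0 : ℝ)..L, g t) * ψ L - c * ψ 0 - ∫ x in (0 : ℝ)..L, g x * ψ x := by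
  have hG : AbsolutelyContinuousOnInterval (fun x => c + ∫ t in (0 : ℝ)..x, g t) 0 L :=
    (contDiffOn_const (c := c)).absolutelyContinuousOnInterval.fun_add
      (hg.absolutelyContinuousOnInterval_intervalIntegral Set.left_mem_uIcc)
  rw [hG.integral_mul_deriv_eq_deriv_mul hψ.contDiffOn.absolutelyContinuousOnInterval,
    intervalIntegral.integral_same, add_zero]
  congr 1
  refine intervalIntegral.integral_congr_ae ?_
  filter_upwards [hg.ae_hasDerivAt_integral] with x hx hmem
  rw [((hx (Set.uIoc_subset_uIcc hmem) 0 Set.left_mem_uIcc).const_add c).deriv]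

theorem setIntegral_Ioo_eq_intervalIntegral (hL : 0 < L) (f : ℝ → ℝ) :
    ∫ x in Set.Ioo 0 L, f x = ∫ x in (0 : ℝ)..L, f x := by
  rw [intervalIntegral.integral_of_le hL.le, integral_Ioc_eq_integral_Ioo]

theorem setIntegral_Ioo_eq_integral {θ : ℝ → ℝ} (hsub : tsupport θ ⊆ Set.Ioo 0 L) (f : ℝ → ℝ) :
    ∫ x in Set.Ioo 0 L, f x * θ x = ∫ x, f x * θ x :=
  setIntegral_eq_integral_of_forall_compl_eq_zero fun x hx => by
    rw [image_eq_zero_of_notMem_tsupport fun h => hx (hsub h), mul_zero]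

/-- A test function on `(0, L)` of zero mean is the derivative of a test function. -/
theorem exists_test_primitive (hL : 0 < L) {θ : ℝ → ℝ} (hθ : ContDiff ℝ ∞ θ)
    (hcomp : HasCompactSupport θ) (hsub : tsupport θ ⊆ Set.Ioo 0 L) (hzero : ∫ x, θ x = 0) :
    ∃ φ : ℝ → ℝ, ContDiff ℝ ∞ φ ∧ HasCompactSupport φ ∧ tsupport φ ⊆ Set.Ioo 0 L ∧
      deriv φ = θ := by
  have hderiv : ∀ x, HasDerivAt (fun x => ∫ t in (0 : ℝ)..x, θ t) (θ x) x := fun x =>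
    intervalIntegral.integral_hasDerivAt_right (hθ.continuous.intervalIntegrable _ _)
      (hθ.continuous.stronglyMeasurableAtFilter _ _) hθ.continuous.continuousAt
  have hd : deriv (fun x => ∫ t in (0 : ℝ)..x, θ t) = θ := funext fun x => (hderiv x).deriv
  -- The point `L / 2` only ensures nonemptiness, as `θ` may vanish identically.
  have hK : IsCompact (tsupport θ ∪ {L / 2}) := hcomp.isCompact.union isCompact_singleton
  have hKne : (tsupport θ ∪ {L / 2}).Nonempty := ⟨L / 2, Or.inr rfl⟩
  have hKsub : tsupport θ ∪ {L / 2} ⊆ Set.Ioo 0 L :=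
    Set.union_subset hsub (Set.singleton_subset_iff.2 ⟨by linarith, by linarith⟩)
  obtain ⟨a, haK, ha⟩ := hK.exists_isLeast hKne
  obtain ⟨b, hbK, hb⟩ := hK.exists_isGreatest hKne
  have hvan : ∀ x, x < a ∨ b < x → θ x = 0 := fun x hx => by
    refine image_eq_zero_of_notMem_tsupport fun h => ?_
    rcases hx with hx | hx
    · exact absurd (ha (Or.inl h)) (not_le.2 hx)
    · exact absurd (hb (Or.inl h)) (not_le.2 hx)
  have hint : ∫ t in (0 : ℝ)..L, θ t = 0 := by
    rw [← setIntegral_Ioo_eq_intervalIntegral hL]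
    refine Eq.trans ?_ hzero
    simpa using setIntegral_Ioo_eq_integral hsub fun _ => 1
  have hsupp : Function.support (fun x => ∫ t in (0 : ℝ)..x, θ t) ⊆ Set.Icc a b := by
    refine Function.support_subset_iff'.2 fun x hx => ?_
    rw [Set.mem_Icc, not_and_or, not_le, not_le] at hx
    rcases hx with hx | hx
    · rw [intervalIntegral.integral_zero_ae]
      refine Eventually.of_forall fun t ht => hvan t (Or.inl ?_)
      exact ht.2.trans_lt (max_lt (hKsub haK).1 hx)
    · have h1 : ∫ t in x..L, θ t = 0 := by
        rw [intervalIntegral.integral_zero_ae]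
        refine Eventually.of_forall fun t ht => hvan t (Or.inr ?_)
        exact (lt_min hx (hKsub hbK).2).trans ht.1
      have h2 := intervalIntegral.integral_add_adjacent_intervals
        (hθ.continuous.intervalIntegrable (μ := volume) 0 x)
        (hθ.continuous.intervalIntegrable x L)
      rw [h1, hint, add_zero] at h2
      exact h2
  have htsupp := closure_minimal hsupp isClosed_Icc
  refine ⟨fun x => ∫ t in (0 : ℝ)..x, θ t, ?_, ?_, ?_, hd⟩
  · refine contDiff_infty_iff_deriv.2 ⟨fun x => (hderiv x).differentiableAt, ?_⟩
    rwa [hd]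
  · exact HasCompactSupport.of_support_subset_isCompact isCompact_Icc hsupp
  · exact htsupp.trans fun x hx => ⟨(hKsub haK).1.trans_le hx.1, hx.2.trans_lt (hKsub hbK).2⟩

/-- The du Bois-Reymond lemma: a function with a weak derivative agrees almost everywhere with a
primitive of that derivative. -/
theorem IsWeakDeriv.ae_eq_primitive (hL : 0 < L) (hv : IntegrableOn v (Set.Ioo 0 L))
    (hg : IntegrableOn g (Set.Ioo 0 L)) (h : IsWeakDeriv L v g) :
    ∃ c : ℝ, ∀ᵐ x ∂volume.restrict (Set.Ioo 0 L), v x = c + ∫ t in (0 : ℝ)..x, g t := by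
  have hg' : IntervalIntegrable g volume 0 L :=
    (intervalIntegrable_iff_integrableOn_Ioo_of_le hL.le).2 hg
  set G : ℝ → ℝ := fun x => ∫ t in (0 : ℝ)..x, g t with hGdef
  have hGi : IntegrableOn G (Set.Ioo 0 L) := by
    have := intervalIntegral.continuousOn_primitive_interval' hg' Set.left_mem_uIcc
    rw [Set.uIcc_of_le hL.le] at this
    exact (this.integrableOn_compact isCompact_Icc).mono_set Set.Ioo_subset_Icc_self
  set w : ℝ → ℝ := fun x => v x - G x with hw
  have hwi : IntegrableOn w (Set.Ioo 0 L) := hv.sub hGi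
  have hmul : ∀ {f θ : ℝ → ℝ}, IntegrableOn f (Set.Ioo 0 L) → ContDiff ℝ ∞ θ →
      IntegrableOn (fun x => f x * θ x) (Set.Ioo 0 L) := fun hf hθ => by
    rw [← intervalIntegrable_iff_integrableOn_Ioo_of_le hL.le] at hf ⊢
    exact hf.mul_continuousOn hθ.continuous.continuousOn
  -- The difference `w` annihilates every derivative of a test function, that is, every test
  -- function of zero mean.
  have horth : ∀ θ : ℝ → ℝ, ContDiff ℝ ∞ θ → HasCompactSupport θ → tsupport θ ⊆ Set.Ioo 0 L →
      ∫ x, θ x = 0 → ∫ x in Set.Ioo 0 L, w x * θ x = 0 := by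
    intro θ hθ hθc hθs hθ0
    obtain ⟨φ, hφ, hφc, hφs, rfl⟩ := exists_test_primitive hL hθ hθc hθs hθ0
    have h1 := h φ hφ hφc hφs
    have h2 := integral_primitive_mul_deriv hg' 0 (hφ.of_le (by exact_mod_cast le_top))
    have hφL : φ L = 0 := image_eq_zero_of_notMem_tsupport fun hm => lt_irrefl _ (hφs hm).2
    simp only [zero_add, hφL, mul_zero, zero_mul, sub_zero, zero_sub] at h2
    rw [← setIntegral_Ioo_eq_intervalIntegral hL, ← setIntegral_Ioo_eq_intervalIntegral hL] at h2
    simp only [hw, sub_mul]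
    rw [integral_sub (hmul hv hθ) (hmul hGi hθ), h1, h2, sub_self]
  obtain ⟨f, hfs, hfc, hf, hfr, hf1⟩ := exists_contDiff_tsupport_subset (n := ⊤)
    (Ioo_mem_nhds (by linarith : (0 : ℝ) < L / 2) (by linarith : L / 2 < L))
  have hf' : ContDiff ℝ ∞ f := hf
  have hfpos : 0 < ∫ x, f x :=
    hf.continuous.integral_pos_of_hasCompactSupport_nonneg_nonzero hfc
      (fun x => (hfr ⟨x, rfl⟩).1) (x := L / 2) (by rw [hf1]; exact one_ne_zero)
  -- The constant is the mean of `w` against the bump `f`. Subtracting a multiple of `f` from any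
  -- test function `η` makes its mean zero, which reduces the general case to `horth`.
  set c : ℝ := (∫ x in Set.Ioo 0 L, w x * f x) / ∫ x, f x with hc
  refine ⟨c, ?_⟩
  have hloc : LocallyIntegrableOn (fun x => w x - c) (Set.Ioo 0 L) volume :=
    (hwi.sub (integrableOn_const (by simp))).locallyIntegrableOn
  have := isOpen_Ioo.ae_eq_zero_of_integral_contDiff_smul_eq_zero hloc ?_
  · refine (ae_restrict_iff' measurableSet_Ioo).2 (this.mono fun x hx hm => ?_)
    have := hx hm
    simp only [hw] at this
    linarith
  · intro η hη hηc hηs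
    set m : ℝ := (∫ x, η x) / ∫ x, f x with hm
    have hθ := horth (fun x => η x - m * f x) (hη.sub (contDiff_const.mul hf'))
      (hηc.sub hfc.mul_left) ((tsupport_sub _ _).trans (Set.union_subset hηs
        ((tsupport_mul_subset_right).trans hfs))) (by
        rw [integral_sub (hη.continuous.integrable_of_hasCompactSupport hηc)
          ((hf.continuous.integrable_of_hasCompactSupport hfc).const_mul m), integral_const_mul, hm,
          div_mul_cancel₀ _ hfpos.ne', sub_self])
    have hexp : ∀ x, w x * (η x - m * f x) = w x * η x - m * (w x * f x) := fun x => by ring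
    simp_rw [hexp] at hθ
    rw [integral_sub (hmul hwi hη) ((hmul hwi hf').const_mul m), integral_const_mul] at hθ
    have hcomm : ∀ x, η x • (w x - c) = (w x - c) * η x := fun x => by
      rw [smul_eq_mul, mul_comm]
    simp_rw [hcomm]
    rw [← setIntegral_Ioo_eq_integral hηs]
    simp only [sub_mul]
    have hconst : ∫ x in Set.Ioo 0 L, c * η x = c * ∫ x, η x := by
      rw [setIntegral_Ioo_eq_integral hηs, integral_const_mul]
    rw [integral_sub (hmul hwi hη) ((hη.continuous.integrable_of_hasCompactSupport
      hηc).integrableOn.const_mul c), hconst]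
    have : m * ∫ x in Set.Ioo 0 L, w x * f x = c * ∫ x, η x := by
      rw [hm, hc]
      ring
    linarith

/-- Passing to the absolutely continuous representative enlarges the test class to `C¹` functions
vanishing at the end points, such as the sine modes. -/
theorem IsWeakDeriv.integral_mul_deriv (hL : 0 < L) (hv : MemL2 L v) (hg : MemL2 L g)
    (h : IsWeakDeriv L v g) {ψ : ℝ → ℝ} (hψ : ContDiff ℝ 1 ψ) (h0 : ψ 0 = 0) (h1 : ψ L = 0) :
    ∫ x in (0 : ℝ)..L, v x * deriv ψ x = -∫ x in (0 : ℝ)..L, g x * ψ x := by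
  obtain ⟨c, hc⟩ := h.ae_eq_primitive hL hv.integrableOn hg.integrableOn
  have := integral_primitive_mul_deriv (hg.intervalIntegrable hL) c hψ
  rw [h0, h1, mul_zero, mul_zero, sub_zero, zero_sub] at this
  rw [← this, intervalIntegral.integral_of_le hL.le, intervalIntegral.integral_of_le hL.le,
    integral_Ioc_eq_integral_Ioo, integral_Ioc_eq_integral_Ioo]
  refine integral_congr_ae ?_
  filter_upwards [hc] with x hx
  rw [hx]

theorem IsWeakDeriv.eq_primitive (hL : 0 < L) (hv : MemL2 L v) (hg : MemL2 L g)
    (h : IsWeakDeriv L v g) (hcont : ContinuousOn v (Set.Icc 0 L)) (h0 : v 0 = 0) :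
    ∀ x ∈ Set.Icc 0 L, v x = ∫ t in (0 : ℝ)..x, g t := by
  obtain ⟨c, hc⟩ := h.ae_eq_primitive hL hv.integrableOn hg.integrableOn
  have hprim : ContinuousOn (fun x => c + ∫ t in (0 : ℝ)..x, g t) (Set.Icc 0 L) := by
    refine continuousOn_const.add ?_
    have := intervalIntegral.continuousOn_primitive_interval' (hg.intervalIntegrable hL)
      Set.left_mem_uIcc
    rwa [Set.uIcc_of_le hL.le] at this
  have hIcc : ∀ᵐ x ∂volume.restrict (Set.Icc 0 L), v x = c + ∫ t in (0 : ℝ)..x, g t := by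
    rwa [← restrict_Ioo_eq_restrict_Icc]
  have heq : Set.EqOn v (fun x => c + ∫ t in (0 : ℝ)..x, g t) (Set.Icc 0 L) :=
    Measure.eqOn_Icc_of_ae_eq volume hL.ne hIcc hcont hprim
  have hc0 : c = 0 := by
    have := heq (Set.left_mem_Icc.2 hL.le)
    simpa [h0] using this.symm
  intro x hx
  simpa [hc0] using heq hx

/-- Here the boundary terms are killed by `v` instead of `ψ`, so that cosines are admissible. -/
theorem IsWeakDeriv.integral_mul_deriv_of_vanishing (hL : 0 < L) (hv : MemL2 L v) (hg : MemL2 L g)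
    (h : IsWeakDeriv L v g) (hcont : ContinuousOn v (Set.Icc 0 L)) (h0 : v 0 = 0) (h1 : v L = 0)
    {ψ : ℝ → ℝ} (hψ : ContDiff ℝ 1 ψ) :
    ∫ x in (0 : ℝ)..L, v x * deriv ψ x = -∫ x in (0 : ℝ)..L, g x * ψ x := by
  have heq := h.eq_primitive hL hv hg hcont h0
  have := integral_primitive_mul_deriv (hg.intervalIntegrable hL) 0 hψ
  rw [zero_add, ← heq L (Set.right_mem_Icc.2 hL.le), h1, zero_mul, zero_mul, sub_zero,
    zero_sub] at this
  rw [← this]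
  refine intervalIntegral.integral_congr fun x hx => ?_
  rw [Set.uIcc_of_le hL.le] at hx
  simp only [zero_add]
  rw [heq x hx]

end Weak

/-! ### Sine and cosine coefficients of weak derivatives -/

section Bessel

variable {L : ℝ} {v : ℝ → ℝ}

/-- The real `n`-th sine coefficient. -/
noncomputable def realSineCoeff (L : ℝ) (v : ℝ → ℝ) (n : ℕ) : ℝ :=
  ∫ x in (0 : ℝ)..L, v x * Real.sin (sineFreq L n * x)

/-- The real `n`-th cosine coefficient. -/
noncomputable def realCosineCoeff (L : ℝ) (v : ℝ → ℝ) (n : ℕ) : ℝ :=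
  ∫ x in (0 : ℝ)..L, v x * Real.cos (sineFreq L n * x)

theorem realSineCoeff_eq_of_memH10 (hL : 0 < L) {g : ℝ → ℝ} (hv : MemL2 L v) (hg : MemL2 L g)
    (h : IsWeakDeriv L v g) (hcont : ContinuousOn v (Set.Icc 0 L)) (h0 : v 0 = 0) (h1 : v L = 0)
    (n : ℕ) : sineFreq L n * realSineCoeff L v n = realCosineCoeff L g n := by
  have hd : ∀ x, deriv (fun x => Real.cos (sineFreq L n * x)) x =
      -(sineFreq L n * Real.sin (sineFreq L n * x)) := fun x => by
    have := ((hasDerivAt_id x).const_mul (sineFreq L n)).cos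
    simp only [id, mul_one] at this
    rw [this.deriv]
    ring
  have := h.integral_mul_deriv_of_vanishing hL hv hg hcont h0 h1
    (ψ := fun x => Real.cos (sineFreq L n * x)) (by fun_prop)
  simp_rw [hd] at this
  rw [realSineCoeff, realCosineCoeff, ← neg_inj, ← this, ← intervalIntegral.integral_const_mul,
    ← intervalIntegral.integral_neg]
  refine intervalIntegral.integral_congr fun x _ => ?_
  ring

theorem realCosineCoeff_eq_of_weakDeriv (hL : 0 < L) {g : ℝ → ℝ} (hv : MemL2 L v) (hg : MemL2 L g)
    (h : IsWeakDeriv L v g) (n : ℕ) :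
    sineFreq L n * realCosineCoeff L v n = -realSineCoeff L g n := by
  have hd : ∀ x, deriv (fun x => Real.sin (sineFreq L n * x)) x =
      sineFreq L n * Real.cos (sineFreq L n * x) := fun x => by
    have := ((hasDerivAt_id x).const_mul (sineFreq L n)).sin
    simp only [id, mul_one] at this
    rw [this.deriv]
    ring
  have := h.integral_mul_deriv hL hv hg
    (ψ := fun x => Real.sin (sineFreq L n * x)) (by fun_prop) (by simp) (by
      have : sineFreq L n * L = (n + 1 : ℕ) * Real.pi := by
        unfold sineFreq
        field_simp
      simp only [this, Real.sin_nat_mul_pi])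
  simp_rw [hd] at this
  rw [realSineCoeff, realCosineCoeff, ← this, ← intervalIntegral.integral_const_mul]
  refine intervalIntegral.integral_congr fun x _ => ?_
  ring

end Bessel

/-! ### Bessel's inequality and the Riesz-Fischer theorem for trigonometric systems on `(0, L)` -/

theorem Continuous.memL2 {L : ℝ} {f : ℝ → ℝ} (hf : Continuous f) : MemL2 L f := by
  refine (memLp_two_iff_integrable_sq hf.aestronglyMeasurable).2 ?_
  exact ((hf.pow 2).integrableOn_Icc (a := 0) (b := L)).mono_set Set.Ioo_subset_Icc_self

theorem MemL2.inner_toLp {L : ℝ} {f g : ℝ → ℝ} (hf : MemL2 L f) (hg : MemL2 L g) :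
    inner ℝ (MemLp.toLp f hf) (MemLp.toLp g hg) = ∫ x in Set.Ioo 0 L, f x * g x := by
  rw [L2.inner_def]
  refine integral_congr_ae ?_
  filter_upwards [MemLp.coeFn_toLp hf, MemLp.coeFn_toLp hg] with x h1 h2
  rw [h1, h2, RCLike.inner_apply, conj_trivial, mul_comm]

section OrthogonalSystem

variable {L C : ℝ} {e : ℕ → ℝ → ℝ}

theorem orthonormal_toLp_of_orthogonal (hC : 0 < C) (hc : ∀ n, Continuous (e n))
    (ho : ∀ m n, ∫ x in Set.Ioo 0 L, e m x * e n x = if m = n then C else 0) :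
    Orthonormal ℝ fun n =>
      MemLp.toLp (fun x => (√C)⁻¹ * e n x) ((continuous_const.mul (hc n)).memL2 (L := L)) := by
  classical
  rw [orthonormal_iff_ite]
  intro m n
  rw [MemL2.inner_toLp]
  have : ∀ x, (√C)⁻¹ * e m x * ((√C)⁻¹ * e n x) = ((√C)⁻¹ * (√C)⁻¹) * (e m x * e n x) :=
    fun x => by ring
  simp_rw [this]
  rw [integral_const_mul, ho, ← mul_inv, Real.mul_self_sqrt hC.le]
  split_ifs
  · exact inv_mul_cancel₀ hC.ne'
  · exact mul_zero _

theorem summable_sq_integral_of_orthogonal (hC : 0 < C) (hc : ∀ n, Continuous (e n))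
    (ho : ∀ m n, ∫ x in Set.Ioo 0 L, e m x * e n x = if m = n then C else 0)
    {g : ℝ → ℝ} (hg : MemL2 L g) :
    Summable fun n => (∫ x in Set.Ioo 0 L, g x * e n x) ^ 2 := by
  have h := (orthonormal_toLp_of_orthogonal hC hc ho).inner_products_summable (MemLp.toLp g hg)
  refine (h.mul_left C).congr fun n => ?_
  rw [MemL2.inner_toLp]
  have : ∀ x, (√C)⁻¹ * e n x * g x = (√C)⁻¹ * (g x * e n x) := fun x => by ring
  simp_rw [this]
  rw [integral_const_mul, Real.norm_eq_abs, sq_abs, mul_pow, inv_pow, Real.sq_sqrt hC.le,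
    mul_inv_cancel_left₀ hC.ne']

/-- Riesz-Fischer in weak form: only pairings with `φ` are recorded, which is all that a weak
derivative sees. -/
theorem exists_memL2_of_summable_sq (hC : 0 < C) (hc : ∀ n, Continuous (e n))
    (ho : ∀ m n, ∫ x in Set.Ioo 0 L, e m x * e n x = if m = n then C else 0)
    {a : ℕ → ℝ} (ha : Summable fun n => a n ^ 2) :
    ∃ h, MemL2 L h ∧ ∀ φ, MemL2 L φ →
      HasSum (fun n => a n * ∫ x in Set.Ioo 0 L, e n x * φ x) (∫ x in Set.Ioo 0 L, h x * φ x) := by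
  have hON := orthonormal_toLp_of_orthogonal hC hc ho
  -- The factor `√C` undoes the normalisation: `√C aₙ` times the unit vector `eₙ / √C` is `aₙ eₙ`.
  have hsum := (hON.orthogonalFamily.summable_iff_norm_sq_summable fun n => √C * a n).2 (by
    refine (ha.mul_left C).congr fun n => ?_
    rw [Real.norm_eq_abs, sq_abs, mul_pow, Real.sq_sqrt hC.le])
  obtain ⟨H, hH⟩ := hsum
  refine ⟨H, Lp.memLp H, fun φ hφ => ?_⟩
  have h1 := hH.mapL (innerSL ℝ (MemLp.toLp φ hφ))
  have h2 : innerSL ℝ (MemLp.toLp φ hφ) H = ∫ x in Set.Ioo 0 L, H x * φ x := by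
    rw [innerSL_apply_apply, real_inner_comm]
    conv_lhs => rw [← Lp.toLp_coeFn H (Lp.memLp H)]
    exact MemL2.inner_toLp (Lp.memLp H) hφ
  rw [h2] at h1
  refine h1.congr_fun fun n => ?_
  rw [innerSL_apply_apply, LinearIsometry.toSpanSingleton_apply, inner_smul_right,
    real_inner_comm, MemL2.inner_toLp]
  have : ∀ x, (√C)⁻¹ * e n x * φ x = (√C)⁻¹ * (e n x * φ x) := fun x => by ring
  simp_rw [this]
  rw [integral_const_mul]
  have : √C ≠ 0 := (Real.sqrt_pos.2 hC).ne'
  field_simp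

end OrthogonalSystem

/-! ### Orthogonality of the modes and decay of coefficients -/

section Trigonometric

variable {L : ℝ}

theorem integral_cos_int_mul (hL : 0 < L) (j : ℤ) :
    ∫ x in (0 : ℝ)..L, Real.cos (Real.pi * j / L * x) = if j = 0 then L else 0 := by
  split_ifs with h
  · simp [h]
  · have hne : Real.pi * j / L ≠ 0 := by
      have : (j : ℝ) ≠ 0 := by exact_mod_cast h
      have := Real.pi_ne_zero
      positivity
    rw [intervalIntegral.integral_comp_mul_left _ hne, integral_cos]
    have : Real.pi * j / L * L = j * Real.pi := by field_simp
    rw [this, Real.sin_int_mul_pi]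
    simp

theorem integral_cos_sub_add (hL : 0 < L) (m n : ℕ) :
    (∫ x in (0 : ℝ)..L, Real.cos (sineFreq L m * x - sineFreq L n * x)) =
        (if m = n then L else 0) ∧
      (∫ x in (0 : ℝ)..L, Real.cos (sineFreq L m * x + sineFreq L n * x)) = 0 := by
  constructor
  · have h := integral_cos_int_mul hL ((m : ℤ) - n)
    have e : ∀ x, sineFreq L m * x - sineFreq L n * x = Real.pi * ((m : ℤ) - n : ℤ) / L * x :=
      fun x => by unfold sineFreq; push_cast; ring
    simp_rw [e]
    rw [h]
    simp only [sub_eq_zero, Nat.cast_inj]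
  -- The shift in `sineFreq` makes the frequency sum `m + n + 2`, which is never zero.
  · have h := integral_cos_int_mul hL ((m : ℤ) + n + 2)
    have e : ∀ x, sineFreq L m * x + sineFreq L n * x = Real.pi * ((m : ℤ) + n + 2 : ℤ) / L * x :=
      fun x => by unfold sineFreq; push_cast; ring
    simp_rw [e]
    rw [h, if_neg (by omega)]

theorem integral_sin_mul_sin (hL : 0 < L) (m n : ℕ) :
    ∫ x in Set.Ioo 0 L, Real.sin (sineFreq L m * x) * Real.sin (sineFreq L n * x) =
      if m = n then L / 2 else 0 := by
  obtain ⟨h1, h2⟩ := integral_cos_sub_add hL m n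
  have e : ∀ x, Real.sin (sineFreq L m * x) * Real.sin (sineFreq L n * x) =
      (Real.cos (sineFreq L m * x - sineFreq L n * x) -
        Real.cos (sineFreq L m * x + sineFreq L n * x)) / 2 := fun x => by
    rw [Real.cos_sub, Real.cos_add]; ring
  simp_rw [e]
  rw [setIntegral_Ioo_eq_intervalIntegral hL, intervalIntegral.integral_div,
    intervalIntegral.integral_sub
      (Continuous.intervalIntegrable (by fun_prop) _ _)
      (Continuous.intervalIntegrable (by fun_prop) _ _), h1, h2]
  split_ifs <;> simp

theorem integral_cos_mul_cos (hL : 0 < L) (m n : ℕ) :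
    ∫ x in Set.Ioo 0 L, Real.cos (sineFreq L m * x) * Real.cos (sineFreq L n * x) =
      if m = n then L / 2 else 0 := by
  obtain ⟨h1, h2⟩ := integral_cos_sub_add hL m n
  have e : ∀ x, Real.cos (sineFreq L m * x) * Real.cos (sineFreq L n * x) =
      (Real.cos (sineFreq L m * x - sineFreq L n * x) +
        Real.cos (sineFreq L m * x + sineFreq L n * x)) / 2 := fun x => by
    rw [Real.cos_sub, Real.cos_add]; ring
  simp_rw [e]
  rw [setIntegral_Ioo_eq_intervalIntegral hL, intervalIntegral.integral_div,
    intervalIntegral.integral_add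
      (Continuous.intervalIntegrable (by fun_prop) _ _)
      (Continuous.intervalIntegrable (by fun_prop) _ _), h1, h2]
  split_ifs <;> simp

theorem summable_sq_realSineCoeff (hL : 0 < L) {g : ℝ → ℝ} (hg : MemL2 L g) :
    Summable fun n => realSineCoeff L g n ^ 2 := by
  have h := summable_sq_integral_of_orthogonal (by positivity : 0 < L / 2)
    (fun n => by fun_prop) (integral_sin_mul_sin hL) hg
  simp only [setIntegral_Ioo_eq_intervalIntegral hL] at h
  exact h

theorem summable_sq_realCosineCoeff (hL : 0 < L) {g : ℝ → ℝ} (hg : MemL2 L g) :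
    Summable fun n => realCosineCoeff L g n ^ 2 := by
  have h := summable_sq_integral_of_orthogonal (by positivity : 0 < L / 2)
    (fun n => by fun_prop) (integral_cos_mul_cos hL) hg
  simp only [setIntegral_Ioo_eq_intervalIntegral hL] at h
  exact h

theorem summable_inv_sineFreq_sq (L : ℝ) : Summable fun n => ((sineFreq L n)⁻¹) ^ 2 := by
  have h := (summable_nat_add_iff 1).2 (Real.summable_one_div_nat_pow.2 one_lt_two)
  refine (h.mul_left ((L / Real.pi) ^ 2)).congr fun n => ?_
  unfold sineFreq
  have := Real.pi_ne_zero
  field_simp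

/-- With `k = sineFreq L n`, apply `xy ≤ (x² + y²) / 2` to `x = k |a|` and `y = 1 / k`. -/
theorem summable_abs_of_summable_sq_sineFreq_mul (hL : 0 < L) {a : ℕ → ℝ}
    (h : Summable fun n => (sineFreq L n * a n) ^ 2) : Summable fun n => |a n| := by
  refine Summable.of_nonneg_of_le (fun n => abs_nonneg _) (fun n => ?_)
    ((h.add (summable_inv_sineFreq_sq L)).div_const 2)
  have hk := sineFreq_pos hL n
  have : |a n| = |sineFreq L n * a n| * (sineFreq L n)⁻¹ := by
    rw [abs_mul, abs_of_pos hk]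
    field_simp
  rw [this, ← sq_abs (sineFreq L n * a n)]
  nlinarith [sq_nonneg (|sineFreq L n * a n| - (sineFreq L n)⁻¹)]

theorem summable_sq_of_summable_abs {a : ℕ → ℝ} (h : Summable fun n => |a n|) :
    Summable fun n => a n ^ 2 := by
  refine Summable.of_nonneg_of_le (fun n => sq_nonneg _) (fun n => ?_) (h.mul_left (∑' n, |a n|))
  rw [← sq_abs, sq]
  exact mul_le_mul_of_nonneg_right (h.le_tsum n fun _ _ => abs_nonneg _) (abs_nonneg _)

theorem MemH10.summable_abs_realSineCoeff (hL : 0 < L) {v : ℝ → ℝ} (hv : MemH10 L v) :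
    Summable fun n => |realSineCoeff L v n| := by
  obtain ⟨⟨hv2, g, hg, hw⟩, hcont, h0, h1⟩ := hv
  refine summable_abs_of_summable_sq_sineFreq_mul hL ?_
  simp_rw [realSineCoeff_eq_of_memH10 hL hv2 hg hw hcont h0 h1]
  exact summable_sq_realCosineCoeff hL hg

/-- The first integration by parts uses that `v` vanishes at the ends, the second that the sines do;
no boundary condition on `v'` is needed. -/
theorem MemH10.summable_sq_realSineCoeff (hL : 0 < L) {v : ℝ → ℝ} (hv : MemH10 L v)
    (hv' : MemH2 L v) : Summable fun n => (sineFreq L n ^ 2 * realSineCoeff L v n) ^ 2 := by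
  obtain ⟨-, hcont, h0, h1⟩ := hv
  obtain ⟨hv2, g, hg, hw, h, hh, hw'⟩ := hv'
  refine (_root_.summable_sq_realSineCoeff hL hh).congr fun n => ?_
  rw [sq (sineFreq L n), mul_assoc, realSineCoeff_eq_of_memH10 hL hv2 hg hw hcont h0 h1,
    realCosineCoeff_eq_of_weakDeriv hL hg hh hw', neg_sq]

end Trigonometric

/-! ### Sobolev regularity of sine series -/

section SeriesRegularity

variable {L : ℝ} {a : ℕ → ℝ}

/-- The real sine series. -/
noncomputable def realSineSeries (L : ℝ) (a : ℕ → ℝ) (x : ℝ) : ℝ :=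
  ∑' n, a n * Real.sin (sineFreq L n * x)

/-- The real cosine series. -/
noncomputable def realCosineSeries (L : ℝ) (a : ℕ → ℝ) (x : ℝ) : ℝ :=
  ∑' n, a n * Real.cos (sineFreq L n * x)

theorem abs_mul_sin_le (b x : ℝ) : ‖b * Real.sin x‖ ≤ |b| := by
  rw [norm_mul]
  exact mul_le_of_le_one_right (abs_nonneg _) (Real.abs_sin_le_one x)

theorem abs_mul_cos_le (b x : ℝ) : ‖b * Real.cos x‖ ≤ |b| := by
  rw [norm_mul]
  exact mul_le_of_le_one_right (abs_nonneg _) (Real.abs_cos_le_one x)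

theorem continuous_realSineSeries (ha : Summable fun n => |a n|) :
    Continuous (realSineSeries L a) :=
  continuous_tsum (fun n => by fun_prop) ha fun _ _ => abs_mul_sin_le _ _

theorem continuous_realCosineSeries (ha : Summable fun n => |a n|) :
    Continuous (realCosineSeries L a) :=
  continuous_tsum (fun n => by fun_prop) ha fun _ _ => abs_mul_cos_le _ _

theorem realSineSeries_endpoints (hL : 0 < L) :
    realSineSeries L a 0 = 0 ∧ realSineSeries L a L = 0 := by
  constructor
  · simp [realSineSeries]
  · refine (tsum_congr fun n => ?_).trans tsum_zero
    have : sineFreq L n * L = (n + 1 : ℕ) * Real.pi := by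
      unfold sineFreq
      field_simp
    rw [this, Real.sin_nat_mul_pi, mul_zero]

theorem hasDerivAt_realSineSeries (ha : Summable fun n => |a n|)
    (ha' : Summable fun n => |sineFreq L n * a n|) (x : ℝ) :
    HasDerivAt (realSineSeries L a) (realCosineSeries L (fun n => sineFreq L n * a n) x) x := by
  refine hasDerivAt_tsum (y₀ := 0) ha' (fun n y => ?_) (fun n y => abs_mul_cos_le _ _)
    (ha.of_norm_bounded fun n => abs_mul_sin_le _ _) x
  have := (((hasDerivAt_id y).const_mul (sineFreq L n)).sin).const_mul (a n)
  refine this.congr_deriv ?_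
  simp only [id]
  ring

theorem isWeakDeriv_of_hasDerivAt (hL : 0 < L) {v g : ℝ → ℝ} (hv : ∀ x, HasDerivAt v (g x) x)
    (hg : Continuous g) : IsWeakDeriv L v g := by
  intro φ hφ _ hs
  have h0 : φ 0 = 0 := image_eq_zero_of_notMem_tsupport fun hm => lt_irrefl _ (hs hm).1
  have h1 : φ L = 0 := image_eq_zero_of_notMem_tsupport fun hm => lt_irrefl _ (hs hm).2
  have hd := (contDiff_infty_iff_deriv.1 hφ)
  have := intervalIntegral.integral_mul_deriv_eq_deriv_mul (a := 0) (b := L)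
    (u := v) (v := φ) (fun x _ => hv x)
    (fun x _ => (hd.1 x).hasDerivAt) (hg.intervalIntegrable _ _)
    (hd.2.continuous.intervalIntegrable _ _)
  rw [setIntegral_Ioo_eq_intervalIntegral hL, setIntegral_Ioo_eq_intervalIntegral hL, this, h0, h1]
  ring

/-- The differentiated series converges only in `L²`, so classical termwise differentiation is
unavailable. Instead each mode is integrated by parts against `φ` and the sums are compared. -/
theorem exists_weakDeriv_realCosineSeries (hL : 0 < L) {c : ℕ → ℝ} (hc : Summable fun n => |c n|)
    (hc2 : Summable fun n => (sineFreq L n * c n) ^ 2) :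
    ∃ h, MemL2 L h ∧ IsWeakDeriv L (realCosineSeries L c) h := by
  obtain ⟨h, hh, hsum⟩ := exists_memL2_of_summable_sq (by positivity : 0 < L / 2)
    (fun n => by fun_prop) (integral_sin_mul_sin hL)
    (a := fun n => -(sineFreq L n * c n)) (by simpa only [neg_sq] using hc2)
  refine ⟨h, hh, fun φ hφ hφc hφs => ?_⟩
  have hd := contDiff_infty_iff_deriv.1 hφ
  have hdc : Continuous (deriv φ) := hd.2.continuous
  have hI : ∀ {f : ℝ → ℝ}, Continuous f → IntegrableOn f (Set.Ioo 0 L) := fun hf =>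
    (hf.integrableOn_Icc (a := 0) (b := L)).mono_set Set.Ioo_subset_Icc_self
  have hs := hasSum_integral_of_summable_integral_norm (μ := volume.restrict (Set.Ioo 0 L))
    (F := fun n x => c n * Real.cos (sineFreq L n * x) * deriv φ x)
    (fun n => hI (by fun_prop)) ?_
  · have hmodes : ∀ n, ∫ x in Set.Ioo 0 L, c n * Real.cos (sineFreq L n * x) * deriv φ x =
        -(-(sineFreq L n * c n) * ∫ x in Set.Ioo 0 L, Real.sin (sineFreq L n * x) * φ x) := by
      intro n
      have := isWeakDeriv_of_hasDerivAt hL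
        (v := fun x => Real.cos (sineFreq L n * x))
        (g := fun x => -(sineFreq L n) * Real.sin (sineFreq L n * x))
        (fun x => by
          refine (((hasDerivAt_id x).const_mul (sineFreq L n)).cos).congr_deriv ?_
          simp only [id]
          ring) (by fun_prop) φ hφ hφc hφs
      simp only [mul_assoc] at this ⊢
      rw [integral_const_mul, this, integral_const_mul]
      ring
    simp_rw [hmodes] at hs
    rw [← hs.unique (hsum φ hφ.continuous.memL2).neg]
    refine integral_congr_ae (Eventually.of_forall fun x => ?_)
    simp only [realCosineSeries]
    rw [tsum_mul_right]
  · refine Summable.of_nonneg_of_le (fun n => integral_nonneg fun s => norm_nonneg _)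
      (fun n => ?_) (hc.mul_right (∫ x in Set.Ioo 0 L, |deriv φ x|))
    rw [← integral_const_mul]
    refine integral_mono (hI (by fun_prop)) (hI (by fun_prop)) fun x => ?_
    change ‖c n * Real.cos (sineFreq L n * x) * deriv φ x‖ ≤ |c n| * |deriv φ x|
    rw [norm_mul]
    exact mul_le_mul_of_nonneg_right (abs_mul_cos_le _ _) (abs_nonneg _)

/-- The chain is `k² a ∈ ℓ²`, so `k a ∈ ℓ¹ ⊆ ℓ²`, so `a ∈ ℓ¹`. The first derivative is thus
classical and only the second is weak. -/
theorem memH10_and_memH2_realSineSeries (hL : 0 < L)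
    (ha : Summable fun n => (sineFreq L n ^ 2 * a n) ^ 2) :
    MemH10 L (realSineSeries L a) ∧ MemH2 L (realSineSeries L a) := by
  have ha2 : Summable fun n => (sineFreq L n * (sineFreq L n * a n)) ^ 2 :=
    ha.congr fun n => by ring
  have ha1 := summable_abs_of_summable_sq_sineFreq_mul hL ha2
  have ha0 := summable_abs_of_summable_sq_sineFreq_mul hL (summable_sq_of_summable_abs ha1)
  have hcont := continuous_realSineSeries (L := L) ha0
  have hcont' := continuous_realCosineSeries (L := L) ha1
  have hweak := isWeakDeriv_of_hasDerivAt hL (hasDerivAt_realSineSeries ha0 ha1) hcont'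
  obtain ⟨h, hh, hw⟩ := exists_weakDeriv_realCosineSeries hL ha1 ha2
  exact ⟨⟨⟨hcont.memL2, _, hcont'.memL2, hweak⟩, hcont.continuousOn, realSineSeries_endpoints hL⟩,
    hcont.memL2, _, hcont'.memL2, hweak, h, hh, hw⟩

end SeriesRegularity

/-! ### The Schrödinger evolution of a sine series -/

/-- The `n`-th sine coefficient at time `t` of the solution with initial coefficients `b`. -/
noncomputable def evolvedCoeff (L γ : ℝ) (V : ℂ) (b : ℕ → ℂ) (t : ℝ) (n : ℕ) : ℂ :=
  b n * Complex.exp (-Complex.I * (γ * sineFreq L n + V) * t)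

section Evolution

variable {L γ : ℝ} {V : ℂ} {b : ℕ → ℂ}

theorem norm_evolvedCoeff (t : ℝ) (n : ℕ) :
    ‖evolvedCoeff L γ V b t n‖ = ‖b n‖ * Real.exp (V.im * t) := by
  rw [evolvedCoeff, norm_mul, Complex.norm_exp]
  congr 2
  simp

theorem summable_norm_evolvedCoeff (hb : Summable fun n => ‖b n‖) (t : ℝ) :
    Summable fun n => ‖evolvedCoeff L γ V b t n‖ := by
  simp_rw [norm_evolvedCoeff]
  exact hb.mul_right _

theorem evolvedCoeff_eq (t : ℝ) (n : ℕ) :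
    evolvedCoeff L γ V b t n = Complex.exp (-Complex.I * V * t) *
      (b n * Complex.exp (-((γ * sineFreq L n * t : ℝ) : ℂ) * Complex.I)) := by
  rw [evolvedCoeff, mul_left_comm, ← Complex.exp_add]
  congr 2
  push_cast
  ring

/-- Factoring out `e^{-iVt}`, whose modulus varies with `t` when `V` is not real, leaves unimodular
factors and hence series bounds uniform in time. -/
theorem sineSeries_evolvedCoeff (x t : ℝ) :
    sineSeries L (evolvedCoeff L γ V b t) x = Complex.exp (-Complex.I * V * t) *
      ∑' n, b n * Complex.exp (-((γ * sineFreq L n * t : ℝ) : ℂ) * Complex.I) *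
        (Real.sin (sineFreq L n * x) : ℂ) := by
  rw [sineSeries, ← tsum_mul_left]
  refine tsum_congr fun n => ?_
  rw [evolvedCoeff_eq]
  ring

theorem norm_mul_exp_mul_sin_le (b : ℂ) (s x : ℝ) :
    ‖b * Complex.exp (-(s : ℂ) * Complex.I) * (Real.sin x : ℂ)‖ ≤ ‖b‖ := by
  refine (norm_mul_sin_le _ _).trans ?_
  rw [norm_mul, ← Complex.ofReal_neg, Complex.norm_exp_ofReal_mul_I, mul_one]

theorem continuous_sineSeries_evolvedCoeff (hb : Summable fun n => ‖b n‖) :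
    Continuous fun p : ℝ × ℝ => sineSeries L (evolvedCoeff L γ V b p.2) p.1 := by
  simp_rw [sineSeries_evolvedCoeff]
  refine Continuous.mul (by fun_prop) ?_
  exact continuous_tsum (fun n => by fun_prop) hb fun n p => norm_mul_exp_mul_sin_le _ _ _

theorem hasDerivAt_sineSeries_evolvedCoeff (hL : 0 < L) (hb : Summable fun n => ‖b n‖)
    (hb' : Summable fun n => ‖b n‖ * sineFreq L n) (x t : ℝ) :
    HasDerivAt (fun s => sineSeries L (evolvedCoeff L γ V b s) x)
      (-Complex.I * (γ * sineSeries L (fun n => sineFreq L n * evolvedCoeff L γ V b t n) x +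
        V * sineSeries L (evolvedCoeff L γ V b t) x)) t := by
  have hser : HasDerivAt (fun s : ℝ => ∑' n,
        b n * Complex.exp (-((γ * sineFreq L n * s : ℝ) : ℂ) * Complex.I) *
          (Real.sin (sineFreq L n * x) : ℂ))
      (∑' n, -Complex.I * γ * (sineFreq L n * b n *
        Complex.exp (-((γ * sineFreq L n * t : ℝ) : ℂ) * Complex.I) *
          (Real.sin (sineFreq L n * x) : ℂ))) t := by
    have hsum0 : Summable fun n => b n *
        Complex.exp (-((γ * sineFreq L n * 0 : ℝ) : ℂ) * Complex.I) *
          (Real.sin (sineFreq L n * x) : ℂ) :=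
      hb.of_norm_bounded fun n => norm_mul_exp_mul_sin_le _ _ _
    refine hasDerivAt_tsum (𝕜 := ℝ) (F := ℂ) (y₀ := 0) (u := fun n => |γ| * (‖b n‖ * sineFreq L n))
      (g := fun n (s : ℝ) => b n * Complex.exp (-((γ * sineFreq L n * s : ℝ) : ℂ) * Complex.I) *
          (Real.sin (sineFreq L n * x) : ℂ))
      (g' := fun n (s : ℝ) => -Complex.I * γ * (sineFreq L n * b n *
        Complex.exp (-((γ * sineFreq L n * s : ℝ) : ℂ) * Complex.I) *
          (Real.sin (sineFreq L n * x) : ℂ)))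
      (hb'.mul_left |γ|) (fun n s => ?_) (fun n s => ?_) hsum0 t
    · have h1 : HasDerivAt (fun s : ℝ => -((γ * sineFreq L n * s : ℝ) : ℂ) * Complex.I)
          (-((γ * sineFreq L n : ℝ) : ℂ) * Complex.I) s := by
        have := ((hasDerivAt_id s).const_mul (γ * sineFreq L n)).ofReal_comp
        simp only [id, mul_one] at this
        exact this.neg.mul_const _
      refine ((h1.cexp.const_mul (b n)).mul_const _).congr_deriv ?_
      push_cast
      ring
    · rw [norm_mul, norm_mul, norm_neg, Complex.norm_I, one_mul, Complex.norm_real,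
        Real.norm_eq_abs]
      refine mul_le_mul_of_nonneg_left ((norm_mul_exp_mul_sin_le _ _ _).trans (le_of_eq ?_))
        (abs_nonneg _)
      rw [norm_mul, Complex.norm_real, Real.norm_of_nonneg (sineFreq_pos hL n).le, mul_comm]
  have hexp : HasDerivAt (fun s : ℝ => Complex.exp (-Complex.I * V * s))
      (Complex.exp (-Complex.I * V * t) * (-Complex.I * V)) t := by
    have := ((hasDerivAt_id t).ofReal_comp.const_mul (-Complex.I * V)).cexp
    simpa using this
  simp_rw [sineSeries_evolvedCoeff]
  refine (hexp.mul hser).congr_deriv ?_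
  have hlap : sineSeries L (fun n => sineFreq L n * evolvedCoeff L γ V b t n) x =
      Complex.exp (-Complex.I * V * t) * ∑' n, sineFreq L n * b n *
        Complex.exp (-((γ * sineFreq L n * t : ℝ) : ℂ) * Complex.I) *
          (Real.sin (sineFreq L n * x) : ℂ) := by
    rw [sineSeries, ← tsum_mul_left]
    refine tsum_congr fun n => ?_
    rw [evolvedCoeff_eq]
    ring
  rw [hlap, tsum_mul_left]
  ring

theorem schrodingerWave_eq_sineSeries (hL : 0 < L) (hb : Summable fun n => ‖b n‖)
    {u0 : ℝ → ℂ} (hu0 : oddPeriodicExt L u0 = sineSeries L b) (x t : ℝ) :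
    schrodingerWave L γ V u0 x t = sineSeries L (evolvedCoeff L γ V b t) x := by
  have hH : ∀ y, hilbertTransform (sineSeries L b) y = -cosineSeries L b y := fun y =>
    (hasHilbertTransformAt_sineSeries hL hb y).hilbertTransform_eq
  rw [schrodingerWave, hu0, hH, hH]
  refine (HasSum.tsum_eq ?_).symm
  have h := ((((hasSum_sineSeries (L := L) hb (x + γ * t)).add
    (hasSum_sineSeries (L := L) hb (x - γ * t))).sub
      ((hasSum_cosineSeries (L := L) hb (x + γ * t)).neg.mul_left Complex.I)).add
        ((hasSum_cosineSeries (L := L) hb (x - γ * t)).neg.mul_left Complex.I)).mul_left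
          (Complex.exp (-Complex.I * V * t) / 2)
  refine h.congr_fun fun n => ?_
  have e : -((γ * sineFreq L n * t : ℝ) : ℂ) * Complex.I =
      ((-(sineFreq L n * (γ * t)) : ℝ) : ℂ) * Complex.I := by
    push_cast
    ring
  rw [evolvedCoeff_eq, e, Complex.exp_mul_I, ← Complex.ofReal_cos, ← Complex.ofReal_sin,
    Real.cos_neg, Real.sin_neg, mul_add (sineFreq L n), mul_sub (sineFreq L n), Real.sin_add,
    Real.sin_sub, Real.cos_add, Real.cos_sub]
  push_cast
  ring

theorem re_sineSeries (hb : Summable fun n => ‖b n‖) (x : ℝ) :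
    (sineSeries L b x).re = realSineSeries L (fun n => (b n).re) x := by
  refine (HasSum.tsum_eq ?_).symm
  refine (Complex.hasSum_re (hasSum_sineSeries hb x)).congr_fun fun n => ?_
  rw [Complex.re_mul_ofReal]

theorem im_sineSeries (hb : Summable fun n => ‖b n‖) (x : ℝ) :
    (sineSeries L b x).im = realSineSeries L (fun n => (b n).im) x := by
  refine (HasSum.tsum_eq ?_).symm
  refine (Complex.hasSum_im (hasSum_sineSeries hb x)).congr_fun fun n => ?_
  rw [Complex.im_mul_ofReal]

theorem isSchrodingerSolution_schrodingerWave (hL : 0 < L)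
    (hb : Summable fun n => (sineFreq L n ^ 2 * ‖b n‖) ^ 2) {u0 : ℝ → ℂ}
    (hext : oddPeriodicExt L u0 = sineSeries L b)
    (hu0 : ∀ x ∈ Set.Icc 0 L, sineSeries L b x = u0 x) :
    IsSchrodingerSolution L γ V u0 (schrodingerWave L γ V u0) := by
  have hb2 : Summable fun n => (sineFreq L n * (sineFreq L n * ‖b n‖)) ^ 2 :=
    hb.congr fun n => by ring
  have hb1 : Summable fun n => |sineFreq L n * ‖b n‖| :=
    summable_abs_of_summable_sq_sineFreq_mul hL hb2
  have hb0 : Summable fun n => ‖b n‖ := by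
    simpa using summable_abs_of_summable_sq_sineFreq_mul hL (summable_sq_of_summable_abs hb1)
  have hb1' : Summable fun n => ‖b n‖ * sineFreq L n := by
    refine hb1.congr fun n => ?_
    rw [abs_of_nonneg (mul_nonneg (sineFreq_pos hL n).le (norm_nonneg _)), mul_comm]
  have hwave : schrodingerWave L γ V u0 = fun x t => sineSeries L (evolvedCoeff L γ V b t) x :=
    funext fun x => funext fun t => schrodingerWave_eq_sineSeries hL hb0 hext x t
  have hreg : ∀ (t : ℝ) (a : ℕ → ℝ), (∀ n, |a n| ≤ ‖evolvedCoeff L γ V b t n‖) →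
      Summable fun n => (sineFreq L n ^ 2 * a n) ^ 2 := by
    intro t a ha
    refine Summable.of_nonneg_of_le (fun n => sq_nonneg _) (fun n => ?_)
      (hb.mul_right (Real.exp (V.im * t) ^ 2))
    rw [← mul_pow, mul_assoc, ← norm_evolvedCoeff (L := L) (γ := γ), ← sq_abs, abs_mul,
      abs_of_nonneg (sq_nonneg (sineFreq L n))]
    have := ha n
    gcongr
  rw [hwave]
  refine ⟨(continuous_sineSeries_evolvedCoeff hb0).continuousOn, fun t _ => ?_, fun t _ => ?_,
    fun x hx => ?_, fun x _ t _ => ?_⟩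
  · simp_rw [re_sineSeries (summable_norm_evolvedCoeff hb0 t)]
    exact memH10_and_memH2_realSineSeries hL (hreg t _ fun n => Complex.abs_re_le_norm _)
  · simp_rw [im_sineSeries (summable_norm_evolvedCoeff hb0 t)]
    exact memH10_and_memH2_realSineSeries hL (hreg t _ fun n => Complex.abs_im_le_norm _)
  · rw [← hu0 x hx]
    congr 1
    ext n
    simp [evolvedCoeff]
  · refine ⟨_, sineSeries L (fun n => sineFreq L n * evolvedCoeff L γ V b t n) x,
      hasDerivAt_sineSeries_evolvedCoeff hL hb0 hb1' x t, ?_, ?_⟩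
    · change HasHalfLaplacianAt (oddPeriodicExt L (sineSeries L (evolvedCoeff L γ V b t))) x _
      rw [oddPeriodicExt_sineSeries hL]
      refine hasHalfLaplacianAt_sineSeries hL (summable_norm_evolvedCoeff hb0 t) ?_ x
      refine (hb1'.mul_right (Real.exp (V.im * t))).congr fun n => ?_
      rw [norm_evolvedCoeff]
      ring
    · linear_combination -(γ * sineSeries L (fun n => sineFreq L n * evolvedCoeff L γ V b t n) x +
        V * sineSeries L (evolvedCoeff L γ V b t) x) * Complex.I_sq

end Evolution

/-! ### Assembly of the theorem -/

theorem sineCoeff_eq_realSineCoeff {L : ℝ} (hL : 0 < L) {v w : ℝ → ℝ} {u : ℝ → ℂ}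
    (hv : ContinuousOn v (Set.Icc 0 L)) (hw : ContinuousOn w (Set.Icc 0 L))
    (hu : ∀ x, u x = v x + Complex.I * w x) (n : ℕ) :
    sineCoeff L u (n + 1) = realSineCoeff L v n + Complex.I * realSineCoeff L w n := by
  have hi : ∀ {f : ℝ → ℝ}, ContinuousOn f (Set.Icc 0 L) →
      IntervalIntegrable (fun x => ((f x * Real.sin (sineFreq L n * x) : ℝ) : ℂ)) volume 0 L := by
    intro f hf
    refine ContinuousOn.intervalIntegrable ?_
    rw [Set.uIcc_of_le hL.le]
    exact Complex.continuous_ofReal.comp_continuousOn (hf.mul (by fun_prop))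
  rw [realSineCoeff, realSineCoeff, ← intervalIntegral.integral_ofReal,
    ← intervalIntegral.integral_ofReal, ← intervalIntegral.integral_const_mul,
    ← intervalIntegral.integral_add (hi hv) ((hi hw).const_mul _)]
  refine intervalIntegral.integral_congr fun x _ => ?_
  simp only [hu, sineFreq_mul]
  push_cast
  ring

/-- All three claims follow from one expansion of the odd extension with coefficients `b`. In `ℂ`
the unconditional convergence expressed by `HasSum` is absolute convergence. -/
theorem mainTheorem3 (L : ℝ) (hL : 0 < L) (γ : ℝ) (V : ℂ) (v0 w0 : ℝ → ℝ)
    (hv0 : MemH10 L v0) (hw0 : MemH10 L w0)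
    (u0 : ℝ → ℂ) (hu0 : ∀ x, u0 x = v0 x + Complex.I * w0 x) :
    (∀ x : ℝ, HasHilbertTransformAt (oddPeriodicExt L u0) x
      (hilbertTransform (oddPeriodicExt L u0) x)) ∧
    (MemH2 L v0 → MemH2 L w0 →
      IsSchrodingerSolution L γ V u0 (schrodingerWave L γ V u0)) ∧
    (∀ x ∈ Set.Icc 0 L, ∀ t : ℝ, 0 ≤ t →
      HasSum (fun n : ℕ => (2 / (L : ℂ)) * (sineCoeff L u0 (n + 1) *
          (Real.sin (Real.pi * (n + 1 : ℕ) * x / L) : ℂ) *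
          Complex.exp (-Complex.I * (γ * Real.pi * (n + 1 : ℕ) / L + V) * t)))
        (schrodingerWave L γ V u0 x t)) := by
  have hcont : ContinuousOn u0 (Set.Icc 0 L) := by
    rw [show u0 = fun x => (v0 x : ℂ) + Complex.I * w0 x from funext hu0]
    exact (Complex.continuous_ofReal.comp_continuousOn hv0.2.1).add
      (continuousOn_const.mul (Complex.continuous_ofReal.comp_continuousOn hw0.2.1))
  have h0 : u0 0 = 0 := by simp [hu0, hv0.2.2.1, hw0.2.2.1]
  have hL0 : u0 L = 0 := by simp [hu0, hv0.2.2.2, hw0.2.2.2]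
  have hcoeff := sineCoeff_eq_realSineCoeff hL hv0.2.1 hw0.2.1 hu0
  have hnorm : ∀ n, ‖sineCoeff L u0 (n + 1)‖ ≤ |realSineCoeff L v0 n| + |realSineCoeff L w0 n| := by
    intro n
    rw [hcoeff]
    refine (norm_add_le _ _).trans (le_of_eq ?_)
    rw [norm_mul, Complex.norm_I, one_mul, Complex.norm_real, Complex.norm_real, Real.norm_eq_abs,
      Real.norm_eq_abs]
  have hs : Summable fun n => ‖sineCoeff L u0 (n + 1)‖ :=
    Summable.of_nonneg_of_le (fun n => norm_nonneg _) hnorm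
      ((hv0.summable_abs_realSineCoeff hL).add (hw0.summable_abs_realSineCoeff hL))
  set b : ℕ → ℂ := fun n => 2 / (L : ℂ) * sineCoeff L u0 (n + 1) with hbdef
  have hbn : ∀ n, ‖b n‖ = 2 / L * ‖sineCoeff L u0 (n + 1)‖ := fun n => by
    rw [hbdef, norm_mul, norm_div, Complex.norm_real, Complex.norm_ofNat,
      Real.norm_of_nonneg hL.le]
  have hb : Summable fun n => ‖b n‖ := by
    simp_rw [hbn]
    exact hs.mul_left _
  have hext : oddPeriodicExt L u0 = sineSeries L b :=
    oddPeriodicExt_eq_sineSeries hL h0 hL0 hcont hs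
  refine ⟨fun x => ?_, fun hv2 hw2 => ?_, fun x _ t _ => ?_⟩
  · have h := hasHilbertTransformAt_sineSeries hL hb x
    rw [hext, h.hilbertTransform_eq]
    exact h
  · refine isSchrodingerSolution_schrodingerWave hL ?_ hext fun x hx =>
      sineSeries_sineCoeff_eq hL h0 hL0 hcont hs hx
    refine Summable.of_nonneg_of_le (fun n => sq_nonneg _) (fun n => ?_)
      (((hv0.summable_sq_realSineCoeff hL hv2).add
        (hw0.summable_sq_realSineCoeff hL hw2)).mul_left (2 * (2 / L) ^ 2))
    -- The inequality `(x + y)² ≤ 2 (x² + y²)` separates real and imaginary data.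
    have h1 : ‖sineCoeff L u0 (n + 1)‖ ^ 2 ≤
        2 * (realSineCoeff L v0 n ^ 2 + realSineCoeff L w0 n ^ 2) := by
      refine (pow_le_pow_left₀ (norm_nonneg _) (hnorm n) 2).trans ?_
      rw [← sq_abs (realSineCoeff L v0 n), ← sq_abs (realSineCoeff L w0 n)]
      exact add_sq_le
    calc (sineFreq L n ^ 2 * ‖b n‖) ^ 2
        = (sineFreq L n ^ 2) ^ 2 * (2 / L) ^ 2 * ‖sineCoeff L u0 (n + 1)‖ ^ 2 := by
          rw [hbn]; ring
      _ ≤ (sineFreq L n ^ 2) ^ 2 * (2 / L) ^ 2 *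
          (2 * (realSineCoeff L v0 n ^ 2 + realSineCoeff L w0 n ^ 2)) := by gcongr
      _ = _ := by ring
  · rw [schrodingerWave_eq_sineSeries hL hb hext]
    refine (hasSum_sineSeries (summable_norm_evolvedCoeff hb t) x).congr_fun fun n => ?_
    rw [evolvedCoeff, sineFreq_mul, hbdef]
    have e : (γ : ℂ) * (sineFreq L n : ℂ) = γ * Real.pi * (n + 1 : ℕ) / L := by
      unfold sineFreq
      push_cast
      ring
    rw [e]
    ring
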